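/- Let $G$ be a group generated by a finite set $X$, with canonical homomorphism $\pi:(X\cup X^{-1})^*\to G$, and let $\phi:A\to B$ be an isomorphism between finitely generated subgroups $A,B$ of $G$. Let $G^*=G*_{t,\phi:A\to B}$ be the HNN extension with stable letter $t$, obtained from $G$ by adding the generator $t$ and the relations $t^{-1}at=\phi(a)$ $(a\in A)$. Assume that (i) the rational subset membership problem is decidable in $G$: there is an algorithm which, given a finite state automaton $\mathcal A$ over $X\cup X^{-1}$ and a word $w\in(X\cup X^{-1})^*$, decides whether $w\pi\in L(\mathcal A)\pi$; (ii) $A$ is effectively closed for rational intersections in $G$: $R\cap A$ is a rational subset of $G$ for every rational subset $R$ of $G$, and there is an algorithm which, given a finite state automaton $\mathcal A$ over $X\cup X^{-1}$, computes a finite state automaton $\mathcal A_A$ over $X\cup X^{-1}$ with $L(\mathcal A_A)\pi=L(\mathcal A)\pi\cap A$. (The rational subsets of $G$ form the smallest class that contains the finite subsets and is closed under union, product and generation of submonoids.) Then for all $d\ge 0$ and all finite subsets $W_0,W_1,\dots,W_d,W_1',\dots,W_d'$ of $G$, the membership problem in $G^*$ for the submonoid $$M=\mathrm{Mon}\langle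 W_0\cup W_1t\cup W_2t^2\cup\dots\cup W_dt^d\cup tW_1'\cup\dots\cup t^dW_d'\rangle$$ is decidable, that is, there is an algorithm which, given a word over $X\cup\{t\}\cup X^{-1}\cup\{t^{-1}\}$, decides whether it represents an element of $M$. The same holds for the submonoid obtained when $t$ is replaced by $t^{-1}$ in the generating set. -/

import Mathlib

/-! ### Words over a finite generating family -/

/-- A word over the doubled alphabet `X ∪ X⁻¹`, where `X` is indexed by `ι`: the letter `(i, true)`
stands for the generator `x i`, the letter `(i, false)` for its formal inverse. -/
abbrev GroupWord (ι : Type*) := List (ι × Bool)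

/-- The canonical homomorphism from words over `X ∪ X⁻¹` to the group `G`. -/
def GroupWord.val {ι G : Type*} [Group G] (x : ι → G) (w : GroupWord ι) : G :=
  (w.map fun l => if l.2 then x l.1 else (x l.1)⁻¹).prod

/-- The family `x` generates the group `G`. -/
def Generates {ι G : Type*} [Group G] (x : ι → G) : Prop :=
  Subgroup.closure (Set.range x) = ⊤

/-- The membership problem for the subset `S` of `G` (where `G` is generated by the family `x`):
there is an algorithm that decides, for a word over `X ∪ X⁻¹`, whether its value lies in `S`. -/
def DecidableMembership {ι G : Type*} [Primcodable ι] [Group G] (x : ι → G) (S : Set G) : Prop :=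
  ComputablePred fun w : GroupWord ι => w.val x ∈ S

/-! ### Finite state automata as finite data -/

/-- A (nondeterministic) finite state automaton over the alphabet `α`, given by finite data
`(E, I, T)`: the list `E` of labelled transitions, the list `I` of initial states and the list `T`
of final states. States are natural numbers; only those that occur in `E`, `I` or `T` matter, so
the state set is finite. -/
abbrev FSA (α : Type*) := List (ℕ × α × ℕ) × List ℕ × List ℕ

/-- The nondeterministic automaton that the data describe. -/
def FSA.toNFA {α : Type*} (𝒜 : FSA α) : NFA α ℕ where
  step p a := {q | (p, a, q) ∈ 𝒜.1}
  start := {p | p ∈ 𝒜.2.1}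
  accept := {p | p ∈ 𝒜.2.2}

/-- The language accepted by the automaton. -/
def FSA.language {α : Type*} (𝒜 : FSA α) : Language α := 𝒜.toNFA.accepts

/-- The subset of `G` represented by an automaton over `X ∪ X⁻¹`: the image of its language under
the canonical homomorphism. -/
def FSA.image {ι G : Type*} [Group G] (x : ι → G) (𝒜 : FSA (ι × Bool)) : Set G :=
  {g | ∃ w : GroupWord ι, w ∈ 𝒜.language ∧ w.val x = g}

/-! ### Rational subsets -/

open scoped Pointwise in
/-- Rational subsets of a group: the smallest class of subsets that contains the finite subsets
and is closed under union, product and generation of submonoids. -/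
inductive IsRationalSubset {G : Type*} [Group G] : Set G → Prop
  | finite (S : Set G) : S.Finite → IsRationalSubset S
  | union (S T : Set G) : IsRationalSubset S → IsRationalSubset T → IsRationalSubset (S ∪ T)
  | mul (S T : Set G) : IsRationalSubset S → IsRationalSubset T → IsRationalSubset (S * T)
  | closure (S : Set G) : IsRationalSubset S →
      IsRationalSubset (Submonoid.closure S : Set G)

/-- The rational subset membership problem is decidable in `G`, generated by the family `x`: there
is an algorithm that takes an automaton `𝒜` over `X ∪ X⁻¹` and a word `w` over `X ∪ X⁻¹`, and
decides whether the value of `w` lies in the subset of `G` represented by `𝒜`. -/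
def DecidableRationalMembership {ι G : Type*} [Primcodable ι] [Group G] (x : ι → G) : Prop :=
  ComputablePred fun p : FSA (ι × Bool) × GroupWord ι => p.2.val x ∈ p.1.image x

/-- The subgroup `H` of `G` is closed for rational intersections. -/
def ClosedForRationalIntersections {G : Type*} [Group G] (H : Subgroup G) : Prop :=
  ∀ R : Set G, IsRationalSubset R → IsRationalSubset (R ∩ (H : Set G))

/-- The subgroup `H` of `G` (generated by the family `x`) is effectively closed for rational
intersections: it is closed for rational intersections, and there is an algorithm that computes
from an automaton for `R` an automaton for `R ∩ H`. -/
def EffectivelyClosedForRationalIntersections {ι G : Type*} [Primcodable ι] [Group G]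
    (x : ι → G) (H : Subgroup G) : Prop :=
  ClosedForRationalIntersections H ∧
    ∃ f : FSA (ι × Bool) → FSA (ι × Bool), Computable f ∧
      ∀ 𝒜 : FSA (ι × Bool), (f 𝒜).image x = 𝒜.image x ∩ (H : Set G)

/-! ### HNN extensions -/

section HNN

variable {G : Type*} [Group G] {A B : Subgroup G} {φ : A ≃* B}

/-- The stable letter of the HNN extension in the convention `t⁻¹ a t = φ a`. (Mathlib's letter
`HNNExtension.t` satisfies `t a t⁻¹ = φ a`.) -/
def stableLetter : HNNExtension G A B φ := HNNExtension.t⁻¹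

theorem stableLetter_conj (a : A) :
    (stableLetter : HNNExtension G A B φ)⁻¹ * HNNExtension.of (a : G) * stableLetter =
      HNNExtension.of (φ a : G) := by
  simp [stableLetter, HNNExtension.equiv_eq_conj]

/-- The generating family `X ∪ {t}` of the HNN extension, for a generating family `x` of `G`. -/
def hnnGenerators {ι : Type*} (φ : A ≃* B) (x : ι → G) : Option ι → HNNExtension G A B φ
  | some i => HNNExtension.of (x i)
  | none => stableLetter

/-- The submonoid of the HNN extension generated by
`W₀ ∪ W₁ s ∪ W₂ s² ∪ ⋯ ∪ W_d s^d ∪ s W₁' ∪ ⋯ ∪ s^d W_d'`, where `s` is a given element. -/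
def hnnSubmonoid (s : HNNExtension G A B φ) (d : ℕ) (W W' : ℕ → Finset G) :
    Submonoid (HNNExtension G A B φ) :=
  Submonoid.closure
    ({u | ∃ g ∈ W 0, u = HNNExtension.of g} ∪
      {u | ∃ i, 1 ≤ i ∧ i ≤ d ∧ ∃ g ∈ W i, u = HNNExtension.of g * s ^ i} ∪
      {u | ∃ i, 1 ≤ i ∧ i ≤ d ∧ ∃ g ∈ W' i, u = s ^ i * HNNExtension.of g})

end HNN

/-! Write `s` for the stable letter, so that `s⁻¹ a s = φ a` for `a ∈ A`, and let `M` be generated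
by finitely many elements `g s ^ i h` with `g`, `h` in `G`; both kinds of generators in the
theorem have this form. The submonoid for `s⁻¹` consists of the inverses of the elements of a
submonoid of this form, so that the roles of `A` and `B` are never exchanged: only `A` is assumed
to be effectively closed for rational intersections.

The membership problems of `A` and `B` and the isomorphisms `φ`, `φ⁻¹` are computable, by search,
so a given word can be brought into reduced form (`GroupWord.exists_computable_reduce`). By
Britton's lemma, an element of `M` is represented only by reduced words in which all exponents of
`s` are positive, and for reduced `g s y` and positive `z` an equation `g s y = r s z` holds if
and only if `g⁻¹ r ∈ A` and `y = φ (g⁻¹ r) z` (`IsReducedList.exists_of_prod_eq`). Consider the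
subsets `R s ^ i h M` with `R ⊆ G` rational. If `i = 0`, the set is split according to the first
generator in which `s` occurs; the generators in the base group that precede it make up a finitely
generated submonoid `K` of `G`. In every case, the `y` with `g s y ∈ R s ^ i h M` are those of
finitely many sets of the same kind, whose rational parts are of the form `φ (g⁻¹ R h K g' ∩ A)`
(`mem_stateSet_iff_exists_crossings`). Reading the reduced word from the left thus leads to the
question whether an element of `G` lies in one of finitely many sets `R h K`, which is an instance
of the rational subset membership problem (`of_mem_stateSet_iff`).

What remains is that `R ↦ φ (R ∩ A)` is computable on automata
(`WordAutomaton.exists_computable_map_inter`). An automaton for `R ∩ A` is given by hypothesis.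
Choose for every useful state `p`, one on a successful path, a word `u_p` that leads from the
initial state to `p`. Then `u_p w u_q⁻¹` lies in `A` for every transition from `p` to `q` with
label `w`, because a successful path passes through it; the word may be replaced by one for its
image under `φ`. Usefulness of states is not computed: the words `u_p` are found by unbounded
search, together with sets of states that certify that no transition needed on a successful path
is lost.

Automata are handled in the form `WordAutomaton`, with words as labels; silent transitions are
subdivided by reading `i i⁻¹` for a generator `i`, and the empty alphabet is treated separately. -/

/-! ### Computable operations on lists, decidable predicates and unbounded search -/

section Computability

variable {α β σ : Type*} [Primcodable α] [Primcodable β] [Primcodable σ]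

theorem Computable.list_foldl {f : α → List β} {g : α → σ} {h : α → σ × β → σ}
    (hf : Computable f) (hg : Computable g) (hh : Computable₂ h) :
    Computable fun a => (f a).foldl (fun s b => h a (s, b)) (g a) := by
  have key : ∀ a, Nat.rec (motive := fun _ => σ) (g a) (fun k s =>
      Option.casesOn ((f a)[k]?) s (fun b => h a (s, b))) (f a).length =
        (f a).foldl (fun s b => h a (s, b)) (g a) := by
    intro a
    suffices H : ∀ n ≤ (f a).length, Nat.rec (motive := fun _ => σ) (g a) (fun k s =>
      Option.casesOn ((f a)[k]?) s (fun b => h a (s, b))) n =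
        ((f a).take n).foldl (fun s b => h a (s, b)) (g a) by
      rw [H _ le_rfl, List.take_length]
    intro n hn
    induction n with
    | zero => simp
    | succ k ih =>
      have hk : k < (f a).length := hn
      rw [List.take_succ_eq_append_getElem hk, List.foldl_append]
      simp only [ih hk.le]
      simp [hk]
  refine Computable.of_eq (Computable.nat_rec (h := fun a p =>
    Option.casesOn ((f a)[p.1]?) p.2 (fun b => h a (p.2, b)))
    (Computable.list_length.comp hf) hg ?_) key
  refine Computable.option_casesOn (o := fun p : α × ℕ × σ => (f p.1)[p.2.1]?)
    (f := fun p => p.2.2) (g := fun p b => h p.1 (p.2.2, b)) ?_ ?_ ?_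
  · exact Computable.list_getElem?.comp (hf.comp Computable.fst)
      (Computable.fst.comp Computable.snd)
  · exact Computable.snd.comp Computable.snd
  · exact hh.comp (Computable.fst.comp Computable.fst)
      (Computable.pair (Computable.snd.comp (Computable.snd.comp Computable.fst)) Computable.snd)

theorem Computable.list_foldr {f : α → List β} {g : α → σ} {h : α → β × σ → σ}
    (hf : Computable f) (hg : Computable g) (hh : Computable₂ h) :
    Computable fun a => (f a).foldr (fun b s => h a (b, s)) (g a) := by
  refine Computable.of_eq (Computable.list_foldl (f := fun a => (f a).reverse)
    (h := fun a p => h a (p.2, p.1)) (Computable.list_reverse.comp hf) hg ?_)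
    fun a => by rw [List.foldl_reverse]
  exact hh.comp Computable.fst
    (Computable.pair (Computable.snd.comp Computable.snd) (Computable.fst.comp Computable.snd))

theorem Computable.list_flatMap {f : α → List β} {g : α → β → List σ}
    (hf : Computable f) (hg : Computable₂ g) : Computable fun a => (f a).flatMap (g a) := by
  refine Computable.of_eq (Computable.list_foldr (h := fun a p => g a p.1 ++ p.2) hf
    (Computable.const []) ?_) fun a => ?_
  · exact Computable.list_append.comp
      (hg.comp Computable.fst (Computable.fst.comp Computable.snd))
      (Computable.snd.comp Computable.snd)
  · induction f a with
    | nil => rfl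
    | cons b l ih => simp [ih]

theorem Computable.list_map {f : α → List β} {g : α → β → σ}
    (hf : Computable f) (hg : Computable₂ g) : Computable fun a => (f a).map (g a) := by
  refine Computable.of_eq (Computable.list_flatMap (g := fun a b => [g a b]) hf ?_) fun a => ?_
  · exact Computable.list_cons.comp hg (Computable.const [])
  · induction f a with
    | nil => rfl
    | cons b l ih => simpa using ih

theorem Computable.list_filterMap {f : α → List β} {g : α → β → Option σ}
    (hf : Computable f) (hg : Computable₂ g) : Computable fun a => (f a).filterMap (g a) := by
  refine Computable.of_eq (Computable.list_flatMap
    (g := fun a b => Option.casesOn (g a b) [] (fun c => [c])) hf ?_) fun a => ?_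
  · exact Computable.option_casesOn (o := fun p : α × β => g p.1 p.2) hg (Computable.const [])
      (Computable.list_cons.comp Computable.snd (Computable.const []))
  · induction f a with
    | nil => rfl
    | cons b l ih => cases hb : g a b <;> simp_all

theorem Computable.computablePred_eq_true {f : α → Bool} (hf : Computable f) :
    ComputablePred fun a => f a = true :=
  ComputablePred.computable_iff.2 ⟨f, hf, rfl⟩

theorem ComputablePred.comp {p : β → Prop} {f : α → β} (hp : ComputablePred p)
    (hf : Computable f) : ComputablePred fun a => p (f a) := by
  obtain ⟨c, hc, rfl⟩ := ComputablePred.computable_iff.1 hp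
  exact (hc.comp hf).computablePred_eq_true

theorem ComputablePred.exists_bool {p : α → Prop} (hp : ComputablePred p) :
    ∃ c : α → Bool, Computable c ∧ ∀ a, c a = true ↔ p a := by
  obtain ⟨c, hc, rfl⟩ := ComputablePred.computable_iff.1 hp
  exact ⟨c, hc, fun _ => Iff.rfl⟩

theorem ComputablePred.and {p q : α → Prop} (hp : ComputablePred p) (hq : ComputablePred q) :
    ComputablePred fun a => p a ∧ q a := by
  obtain ⟨c, hc, rfl⟩ := ComputablePred.computable_iff.1 hp
  obtain ⟨d, hd, rfl⟩ := ComputablePred.computable_iff.1 hq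
  refine ComputablePred.of_eq (Computable.computablePred_eq_true
    (f := fun a => c a && d a) ?_) fun a => by simp
  exact Primrec.and.to_comp.comp hc hd

theorem ComputablePred.or {p q : α → Prop} (hp : ComputablePred p) (hq : ComputablePred q) :
    ComputablePred fun a => p a ∨ q a :=
  (hp.not.and hq.not).not.of_eq fun a => by tauto

theorem ComputablePred.imp {p q : α → Prop} (hp : ComputablePred p) (hq : ComputablePred q) :
    ComputablePred fun a => p a → q a :=
  (hp.not.or hq).of_eq fun a => by tauto

theorem ComputablePred.forall_mem {f : α → List β} {p : α → β → Prop} (hf : Computable f)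
    (hp : ComputablePred fun q : α × β => p q.1 q.2) :
    ComputablePred fun a => ∀ b ∈ f a, p a b := by
  obtain ⟨c, hc, h⟩ := hp.exists_bool
  have h' : ∀ a b, p a b ↔ c (a, b) = true := fun a b => (h (a, b)).symm
  refine ComputablePred.of_eq (Computable.computablePred_eq_true
    (f := fun a => (f a).foldr (fun b s => c (a, b) && s) true)
    (Computable.list_foldr (h := fun a p => c (a, p.1) && p.2) hf (Computable.const true) ?_))
    fun a => ?_
  · exact Primrec.and.to_comp.comp (hc.comp (Computable.pair Computable.fst
      (Computable.fst.comp Computable.snd))) (Computable.snd.comp Computable.snd)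
  · simp only [h']
    induction f a with
    | nil => simp
    | cons b l ih => simp [ih]

theorem ComputablePred.exists_mem {f : α → List β} {p : α → β → Prop} (hf : Computable f)
    (hp : ComputablePred fun q : α × β => p q.1 q.2) :
    ComputablePred fun a => ∃ b ∈ f a, p a b :=
  (ComputablePred.forall_mem (p := fun a b => ¬ p a b) hf hp.not).not.of_eq fun a => by
    push Not; rfl

theorem Computable.computablePred_eq [DecidableEq β] {f g : α → β} (hf : Computable f)
    (hg : Computable g) : ComputablePred fun a => f a = g a :=
  (PrimrecPred.computablePred (α := β × β) (p := fun q => q.1 = q.2) Primrec.eq).comp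
    (hf.pair hg)

theorem Computable.computablePred_mem [DecidableEq β] {f : α → β} {l : α → List β}
    (hf : Computable f) (hl : Computable l) : ComputablePred fun a => f a ∈ l a :=
  (ComputablePred.exists_mem (p := fun a b => b = f a) hl
    (Computable.computablePred_eq Computable.snd (hf.comp Computable.fst))).of_eq fun a => by simp

/-- Unbounded search: a decidable relation that is total has a computable choice function. -/
theorem ComputablePred.exists_computable_choice {P : α → β → Prop}
    (hP : ComputablePred fun q : α × β => P q.1 q.2) (h : ∀ a, ∃ b, P a b) :
    ∃ f : α → β, Computable f ∧ ∀ a, P a (f a) := by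
  obtain ⟨c, hc, hcP⟩ := hP.exists_bool
  let F : α → ℕ → Option β := fun a n =>
    (Encodable.decode (α := β) n).bind fun b => bif c (a, b) then some b else none
  have hF : Computable₂ F := by
    refine Computable.option_bind (Computable.decode.comp Computable.snd) ?_
    refine Computable.cond (hc.comp ?_) (Computable.option_some.comp Computable.snd)
      (Computable.const none)
    exact Computable.pair (Computable.fst.comp Computable.fst) Computable.snd
  have hdom : ∀ a, (Nat.rfindOpt (F a)).Dom := by
    intro a
    obtain ⟨b, hb⟩ := h a
    refine Nat.rfindOpt_dom.2 ⟨Encodable.encode b, b, ?_⟩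
    simp [F, (hcP (a, b)).2 hb]
  refine ⟨fun a => (Nat.rfindOpt (F a)).get (hdom a),
    Partrec.of_eq_tot (Partrec.rfindOpt hF) fun a => Part.get_mem _, fun a => ?_⟩
  obtain ⟨n, hn⟩ := Nat.rfindOpt_spec (Part.get_mem (hdom a))
  simp only [F, Option.mem_def, Option.bind_eq_some_iff] at hn
  obtain ⟨b, -, hb⟩ := hn
  cases hcb : c (a, b) with
  | false => simp [hcb] at hb
  | true =>
    simp only [hcb, cond_true, Option.some.injEq] at hb
    subst hb
    exact (hcP _).1 hcb

end Computability

/-! ### Words: inversion, substitution and their values -/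

namespace GroupWord

variable {ι κ G H : Type*} [Group G] [Group H]

@[simp]
theorem val_nil (x : ι → G) : GroupWord.val x [] = 1 := rfl

theorem val_cons (x : ι → G) (l : ι × Bool) (w : GroupWord ι) :
    GroupWord.val x (l :: w) = (if l.2 then x l.1 else (x l.1)⁻¹) * GroupWord.val x w := by
  simp [GroupWord.val]

@[simp]
theorem val_append (x : ι → G) (v w : GroupWord ι) :
    GroupWord.val x (v ++ w) = GroupWord.val x v * GroupWord.val x w := by
  simp [GroupWord.val]

/-- The formal inverse of a word. -/
def inv (w : GroupWord ι) : GroupWord ι := (w.map fun l => (l.1, !l.2)).reverse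

@[simp]
theorem val_inv (x : ι → G) (w : GroupWord ι) : (inv w).val x = (w.val x)⁻¹ := by
  induction w with
  | nil => simp [inv]
  | cons l w ih =>
    have : inv (l :: w) = inv w ++ [(l.1, !l.2)] := by simp [inv]
    rw [this, val_append, ih, val_cons x l, mul_inv_rev, val_cons]
    cases l.2 <;> simp

theorem computable_inv [Primcodable ι] : Computable (inv : GroupWord ι → GroupWord ι) := by
  refine Computable.list_reverse.comp (Computable.list_map Computable.id ?_)
  exact Computable.pair (Computable.fst.comp Computable.snd)
    (Primrec.not.to_comp.comp (Computable.snd.comp Computable.snd))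

/-- Substitution of the word `v k` for every letter `k`. -/
def subst (v : κ → GroupWord ι) (w : GroupWord κ) : GroupWord ι :=
  w.flatMap fun l => if l.2 then v l.1 else inv (v l.1)

theorem val_subst (x : ι → G) (v : κ → GroupWord ι) (w : GroupWord κ) :
    (subst v w).val x = w.val fun k => (v k).val x := by
  induction w with
  | nil => rfl
  | cons l w ih =>
    have : subst v (l :: w) = (if l.2 then v l.1 else inv (v l.1)) ++ subst v w := by simp [subst]
    rw [this, val_append, ih, val_cons]
    cases l.2 <;> simp

theorem computable_subst [Primcodable ι] [Primcodable κ] [Finite κ] (v : κ → GroupWord ι) :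
    Computable (subst v) := by
  have : Finite (κ × Bool) := inferInstance
  exact Computable.list_flatMap Computable.id
    ((Primrec.dom_finite (fun l : κ × Bool => if l.2 then v l.1 else inv (v l.1))).to_comp.comp
      Computable.snd)

theorem map_val (f : G →* H) (x : ι → G) (w : GroupWord ι) :
    f (w.val x) = w.val fun i => f (x i) := by
  induction w with
  | nil => simp
  | cons l w ih =>
    rw [val_cons, val_cons, map_mul, ih]
    cases l.2 <;> simp

theorem exists_val_eq_iff_mem_closure (x : ι → G) (g : G) :
    (∃ w : GroupWord ι, w.val x = g) ↔ g ∈ Subgroup.closure (Set.range x) := by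
  constructor
  · rintro ⟨w, rfl⟩
    induction w with
    | nil => exact one_mem _
    | cons l w ih =>
      have h : x l.1 ∈ Subgroup.closure (Set.range x) := Subgroup.subset_closure ⟨_, rfl⟩
      rw [val_cons]
      refine mul_mem ?_ ih
      split_ifs
      exacts [h, inv_mem h]
  · intro h
    induction h using Subgroup.closure_induction with
    | mem g hg =>
      obtain ⟨i, rfl⟩ := hg
      exact ⟨[(i, true)], by simp [val_cons]⟩
    | one => exact ⟨[], rfl⟩
    | mul a b _ _ ha hb =>
      obtain ⟨v, rfl⟩ := ha
      obtain ⟨w, rfl⟩ := hb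
      exact ⟨v ++ w, val_append _ _ _⟩
    | inv a _ ha =>
      obtain ⟨v, rfl⟩ := ha
      exact ⟨inv v, val_inv _ _⟩

end GroupWord

theorem Generates.exists_word {ι G : Type*} [Group G] {x : ι → G} (hx : Generates x) (g : G) :
    ∃ w : GroupWord ι, w.val x = g :=
  (GroupWord.exists_val_eq_iff_mem_closure x g).2 (by rw [show _ = _ from hx]; trivial)

/-! ### Automata whose transitions are labelled by words -/

/-- A finite automaton whose transitions are labelled by words, given by the list of its
transitions; an empty label makes a silent transition. The initial state is `0`, the only final
state is `1`. -/
abbrev WordAutomaton (ι : Type*) := List (ℕ × GroupWord ι × ℕ)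

namespace WordAutomaton

variable {ι G : Type*} [Group G]

/-- `Path x E p g q`: some path of `E` from the state `p` to the state `q` has a label with
value `g`. -/
inductive Path (x : ι → G) (E : WordAutomaton ι) : ℕ → G → ℕ → Prop
  | nil (p : ℕ) : Path x E p 1 p
  | cons {p q r : ℕ} {w : GroupWord ι} {g : G} :
      (p, w, q) ∈ E → Path x E q g r → Path x E p (w.val x * g) r

/-- The subset of `G` that consists of the values of the labels of successful paths. -/
def image (x : ι → G) (E : WordAutomaton ι) : Set G := {g | Path x E 0 g 1}

variable {x : ι → G} {E : WordAutomaton ι} {p q r : ℕ} {g h : G} {w : GroupWord ι}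

theorem Path.single (he : (p, w, q) ∈ E) : Path x E p (w.val x) q := by
  simpa using Path.cons (x := x) he (Path.nil q)

theorem Path.trans (h₁ : Path x E p g q) (h₂ : Path x E q h r) : Path x E p (g * h) r := by
  induction h₁ with
  | nil => simpa using h₂
  | cons he _ ih => simpa [mul_assoc] using Path.cons he (ih h₂)

/-- Backward induction along a path: a relation that holds at the end and is inherited backwards
along transitions holds at the start. -/
theorem Path.invariant {C : ℕ → G → Prop} (hp : Path x E p g r) (hr : C r 1)
    (hC : ∀ p w q g, (p, w, q) ∈ E → C q g → C p (w.val x * g)) : C p g := by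
  induction hp with
  | nil => exact hr
  | cons he _ ih => exact hC _ _ _ _ he (ih hr)

/-! ### Translation to and from automata with letter transitions -/

/-- The transitions of an `FSA`, with their letters regarded as words of length one. -/
def letters (𝒜 : FSA (ι × Bool)) : WordAutomaton ι := 𝒜.1.map fun e => (e.1, [e.2.1], e.2.2)

theorem mem_letters {𝒜 : FSA (ι × Bool)} :
    (p, w, q) ∈ letters 𝒜 ↔ ∃ l, w = [l] ∧ (p, l, q) ∈ 𝒜.1 := by
  simp only [letters, List.mem_map, Prod.mk.injEq]
  constructor
  · rintro ⟨⟨a, l, b⟩, h, rfl, rfl, rfl⟩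
    exact ⟨l, rfl, h⟩
  · rintro ⟨l, rfl, h⟩
    exact ⟨(p, l, q), h, rfl, rfl, rfl⟩

theorem path_letters_iff (𝒜 : FSA (ι × Bool)) :
    Path x (letters 𝒜) p g q ↔ ∃ w : GroupWord ι, q ∈ 𝒜.toNFA.evalFrom {p} w ∧ w.val x = g := by
  constructor
  · intro hp
    refine hp.invariant (C := fun p g => ∃ w : GroupWord ι,
      q ∈ 𝒜.toNFA.evalFrom {p} w ∧ w.val x = g) ⟨[], by simp, rfl⟩ ?_
    rintro p _ r _ he ⟨w, hw, rfl⟩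
    obtain ⟨l, rfl, hl⟩ := mem_letters.1 he
    refine ⟨l :: w, ?_, by simp [GroupWord.val_cons]⟩
    rw [NFA.evalFrom_cons, NFA.mem_evalFrom_iff_exists]
    exact ⟨r, by simpa [FSA.toNFA] using hl, hw⟩
  · rintro ⟨w, hw, rfl⟩
    induction w generalizing p with
    | nil =>
      obtain rfl : q = p := by simpa using hw
      exact .nil _
    | cons l w ih =>
      rw [NFA.evalFrom_cons, NFA.mem_evalFrom_iff_exists] at hw
      obtain ⟨r, hr, hw⟩ := hw
      have he : (p, [l], r) ∈ letters 𝒜 :=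
        mem_letters.2 ⟨l, rfl, by simpa [FSA.toNFA] using hr⟩
      simpa [GroupWord.val_cons] using Path.cons (x := x) he (ih hw)

theorem mem_image_FSA_iff (𝒜 : FSA (ι × Bool)) :
    g ∈ 𝒜.image x ↔ ∃ p ∈ 𝒜.2.1, ∃ q ∈ 𝒜.2.2, Path x (letters 𝒜) p g q := by
  simp only [path_letters_iff, FSA.image, FSA.language, Set.mem_ofPred_eq, NFA.mem_accepts]
  constructor
  · rintro ⟨w, ⟨q, hq, hw⟩, rfl⟩
    obtain ⟨p, hp, hw⟩ := NFA.mem_evalFrom_iff_exists.1 hw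
    exact ⟨p, hp, q, hq, w, hw, rfl⟩
  · rintro ⟨p, hp, q, hq, w, hw, rfl⟩
    exact ⟨w, ⟨q, hq, NFA.mem_evalFrom_iff_exists.2 ⟨p, hp, hw⟩⟩, rfl⟩

/-- An automaton with letter transitions as a word automaton: its states are shifted by two, and
silent transitions lead from the new initial state and to the new final state. -/
def ofFSA (𝒜 : FSA (ι × Bool)) : WordAutomaton ι :=
  𝒜.2.1.map (fun p => (0, [], p + 2)) ++ 𝒜.2.2.map (fun p => (p + 2, [], 1)) ++
    𝒜.1.map fun e => (e.1 + 2, [e.2.1], e.2.2 + 2)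

theorem image_ofFSA (x : ι → G) (𝒜 : FSA (ι × Bool)) : (ofFSA 𝒜).image x = 𝒜.image x := by
  ext g
  rw [mem_image_FSA_iff]
  constructor
  · intro hg
    have := Path.invariant (C := fun s g => (s = 1 → g = 1) ∧
      (∀ p, s = p + 2 → ∃ q ∈ 𝒜.2.2, Path x (letters 𝒜) p g q) ∧
      (s = 0 → ∃ p ∈ 𝒜.2.1, ∃ q ∈ 𝒜.2.2, Path x (letters 𝒜) p g q)) hg (by simp) ?_
    · exact this.2.2 rfl
    · rintro p w q g he ⟨h₁, h₂, -⟩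
      simp only [ofFSA, List.mem_append, List.mem_map, Prod.mk.injEq] at he
      rcases he with (⟨p', hp', rfl, rfl, rfl⟩ | ⟨p', hp', rfl, rfl, rfl⟩) |
        ⟨⟨a, l, b⟩, hl, rfl, rfl, rfl⟩
      · refine ⟨by simp, by simp, fun _ => ⟨p', hp', ?_⟩⟩
        simpa using h₂ p' rfl
      · refine ⟨by simp, fun p hp => ⟨p', hp', ?_⟩, by simp⟩
        obtain rfl : p' = p := by simpa using hp
        simpa [h₁ rfl] using Path.nil (x := x) (E := letters 𝒜) p'
      · refine ⟨by simp, fun p hp => ?_, by simp⟩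
        obtain rfl : a = p := by simpa using hp
        obtain ⟨q, hq, hb⟩ := h₂ b rfl
        exact ⟨q, hq, .cons (mem_letters.2 ⟨l, rfl, hl⟩) hb⟩
  · rintro ⟨p, hp, q, hq, hg⟩
    have h₁ : Path x (ofFSA 𝒜) (p + 2) g 1 := by
      refine hg.invariant (C := fun p g => Path x (ofFSA 𝒜) (p + 2) g 1) ?_ ?_
      · exact Path.single (w := []) (by simp [ofFSA, hq])
      · intro p w r g he hr
        obtain ⟨l, rfl, hl⟩ := mem_letters.1 he
        refine .cons ?_ hr
        simp only [ofFSA, List.mem_append, List.mem_map, Prod.mk.injEq]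
        exact .inr ⟨(p, l, r), hl, rfl, rfl, rfl⟩
    have h₀ : ((0, [], p + 2) : ℕ × GroupWord ι × ℕ) ∈ ofFSA 𝒜 := by simp [ofFSA, hp]
    simpa [image] using Path.cons (x := x) h₀ h₁

theorem computable_ofFSA [Primcodable ι] :
    Computable (ofFSA : FSA (ι × Bool) → WordAutomaton ι) := by
  unfold ofFSA
  have add2 : Computable fun p : ℕ => p + 2 := (Primrec.succ.comp Primrec.succ).to_comp
  refine Computable.list_append.comp (Computable.list_append.comp ?_ ?_) ?_
  · exact Computable.list_map (g := fun _ p => ((0, [], p + 2) : ℕ × GroupWord ι × ℕ))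
      (Computable.fst.comp Computable.snd)
      (Computable.pair (Computable.const _) (Computable.pair (Computable.const _)
        (add2.comp Computable.snd)))
  · exact Computable.list_map (g := fun _ p => ((p + 2, [], 1) : ℕ × GroupWord ι × ℕ))
      (Computable.snd.comp Computable.snd)
      (Computable.pair (add2.comp Computable.snd) (Computable.const _))
  · exact Computable.list_map
      (g := fun _ (e : ℕ × (ι × Bool) × ℕ) =>
        ((e.1 + 2, [e.2.1], e.2.2 + 2) : ℕ × GroupWord ι × ℕ)) Computable.fst
      (Computable.pair (add2.comp (Computable.fst.comp Computable.snd))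
        (Computable.pair (Computable.list_cons.comp
          (Computable.fst.comp (Computable.snd.comp Computable.snd)) (Computable.const []))
        (add2.comp (Computable.snd.comp (Computable.snd.comp Computable.snd)))))

section Subdivision

variable [Primcodable ι]

/-- The state in which the word `w` remains to be read before the state `q` is reached. -/
def readState (w : GroupWord ι) (q : ℕ) : ℕ := Encodable.encode (w, q)

theorem readState_inj {v w : GroupWord ι} : readState v p = readState w q ↔ v = w ∧ p = q := by
  simp [readState]

/-- The transitions that read the word `w`, letter by letter, on the way to the state `q`. -/
def readEdges (q : ℕ) : GroupWord ι → List (ℕ × (ι × Bool) × ℕ)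
  | [] => []
  | l :: w => (readState (l :: w) q, l, readState w q) :: readEdges q w

theorem exists_of_mem_readEdges {l : ι × Bool} (hl : (p, l, r) ∈ readEdges q w) :
    ∃ v, p = readState (l :: v) q ∧ r = readState v q := by
  induction w with
  | nil => simp [readEdges] at hl
  | cons m w ih =>
    rw [readEdges, List.mem_cons] at hl
    rcases hl with hl | hl
    · simp only [Prod.mk.injEq] at hl
      obtain ⟨rfl, rfl, rfl⟩ := hl
      exact ⟨w, rfl, rfl⟩
    · exact ih hl

/-- The transitions with letters that replace a transition `e` labelled by a word. The label is
preceded by `i i⁻¹` for a fixed generator `i`, so that the word to be read is never empty. -/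
def paddedEdges (i : ι) (e : ℕ × GroupWord ι × ℕ) : List (ℕ × (ι × Bool) × ℕ) :=
  (readState ([] : GroupWord ι) e.1, (i, true), readState ((i, false) :: e.2.1) e.2.2) ::
    readEdges e.2.2 ((i, false) :: e.2.1)

/-- The automaton with letter transitions that arises by subdividing the transitions of `E`. -/
def toFSA (i : ι) (E : WordAutomaton ι) : FSA (ι × Bool) :=
  (E.flatMap (paddedEdges i), [readState ([] : GroupWord ι) 0], [readState ([] : GroupWord ι) 1])

theorem computable_toFSA (i : ι) : Computable (toFSA i : WordAutomaton ι → FSA (ι × Bool)) := by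
  have hS : Primrec₂ (readState : GroupWord ι → ℕ → ℕ) := Primrec.encode
  have hR : Primrec₂ (readEdges : ℕ → GroupWord ι → List (ℕ × (ι × Bool) × ℕ)) := by
    refine Primrec.of_eq (f := fun a : ℕ × GroupWord ι => List.recOn
      (motive := fun _ => List (ℕ × (ι × Bool) × ℕ)) a.2 []
      (fun l w IH => (readState (l :: w) a.1, l, readState w a.1) :: IH)) ?_ ?_
    · refine Primrec.list_rec (h := fun (a : ℕ × GroupWord ι)
        (b : (ι × Bool) × GroupWord ι × List (ℕ × (ι × Bool) × ℕ)) =>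
        (readState (b.1 :: b.2.1) a.1, b.1, readState b.2.1 a.1) :: b.2.2)
        Primrec.snd (Primrec.const []) ?_
      have hq : Primrec fun c : (ℕ × GroupWord ι) ×
          ((ι × Bool) × GroupWord ι × List (ℕ × (ι × Bool) × ℕ)) => c.1.1 :=
        Primrec.fst.comp Primrec.fst
      have hl : Primrec fun c : (ℕ × GroupWord ι) ×
          ((ι × Bool) × GroupWord ι × List (ℕ × (ι × Bool) × ℕ)) => c.2.1 :=
        Primrec.fst.comp Primrec.snd
      have hw : Primrec fun c : (ℕ × GroupWord ι) ×
          ((ι × Bool) × GroupWord ι × List (ℕ × (ι × Bool) × ℕ)) => c.2.2.1 :=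
        Primrec.fst.comp (Primrec.snd.comp Primrec.snd)
      exact Primrec.list_cons.comp (Primrec.pair (hS.comp (Primrec.list_cons.comp hl hw) hq)
        (Primrec.pair hl (hS.comp hw hq))) (Primrec.snd.comp (Primrec.snd.comp Primrec.snd))
    · rintro ⟨q, w⟩
      induction w with
      | nil => rfl
      | cons l w ih => simpa [readEdges] using ih
  have hw : Primrec fun e : ℕ × GroupWord ι × ℕ => (i, false) :: e.2.1 :=
    Primrec.list_cons.comp (Primrec.const _) (Primrec.fst.comp Primrec.snd)
  have hq : Primrec fun e : ℕ × GroupWord ι × ℕ => e.2.2 := Primrec.snd.comp Primrec.snd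
  have hP : Primrec (paddedEdges i) :=
    Primrec.list_cons.comp (Primrec.pair (hS.comp (Primrec.const _) Primrec.fst)
      (Primrec.pair (Primrec.const _) (hS.comp hw hq))) (hR.comp hq hw)
  exact Computable.pair (Primrec.list_flatMap Primrec.id (hP.comp Primrec.snd).to₂).to_comp
    (Computable.const _)

theorem path_readEdges {𝒜 : FSA (ι × Bool)} (v : GroupWord ι) :
    ∀ w, v <:+ w → (∀ e ∈ readEdges q w, e ∈ 𝒜.1) →
      Path x (letters 𝒜) (readState v q) (v.val x) (readState ([] : GroupWord ι) q) := by
  induction v with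
  | nil => exact fun _ _ _ => .nil _
  | cons l v ih =>
    intro w hw h𝒜
    have hmem : (readState (l :: v) q, l, readState v q) ∈ readEdges q w := by
      clear h𝒜 ih
      induction w with
      | nil => simp at hw
      | cons m w ih =>
        rw [readEdges]
        rcases List.suffix_cons_iff.1 hw with hw | hw
        · cases hw
          exact List.mem_cons_self
        · exact List.mem_cons_of_mem _ (ih hw)
    have := Path.cons (x := x) (mem_letters.2 ⟨l, rfl, h𝒜 _ hmem⟩)
      (ih w ((List.suffix_cons l v).trans hw) h𝒜)
    simpa [GroupWord.val_cons] using this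

theorem image_toFSA (x : ι → G) (i : ι) (E : WordAutomaton ι) :
    (toFSA i E).image x = E.image x := by
  ext g
  rw [mem_image_FSA_iff]
  change (∃ p ∈ [readState ([] : GroupWord ι) 0], ∃ q ∈ [readState ([] : GroupWord ι) 1],
    Path x (letters (toFSA i E)) p g q) ↔ _
  simp only [List.mem_singleton, exists_eq_left]
  constructor
  · intro hg
    have := hg.invariant (C := fun s g => ∀ v q, s = readState v q →
      ∃ h, Path x E q h 1 ∧ g = GroupWord.val x v * h) ?_ ?_
    · obtain ⟨h, hh, rfl⟩ := this [] 0 rfl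
      simpa [image] using hh
    · intro v q hv
      obtain ⟨rfl, rfl⟩ := readState_inj.1 hv
      exact ⟨1, .nil _, by simp⟩
    · intro p w r g he hr v q hv
      obtain ⟨l, rfl, hl⟩ := mem_letters.1 he
      simp only [toFSA, List.mem_flatMap, paddedEdges, List.mem_cons] at hl
      obtain ⟨⟨a, u, b⟩, hE, he | he⟩ := hl
      · simp only [Prod.mk.injEq] at he
        obtain ⟨rfl, rfl, rfl⟩ := he
        obtain ⟨rfl, rfl⟩ := readState_inj.1 hv
        obtain ⟨h, hh, rfl⟩ := hr _ _ rfl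
        exact ⟨_, .cons hE hh, by simp [GroupWord.val_cons, mul_assoc]⟩
      · obtain ⟨v', rfl, rfl⟩ := exists_of_mem_readEdges he
        obtain ⟨rfl, rfl⟩ := readState_inj.1 hv
        obtain ⟨h, hh, rfl⟩ := hr _ _ rfl
        exact ⟨h, hh, by simp [GroupWord.val_cons, mul_assoc]⟩
  · intro hg
    refine Path.invariant (C := fun p g => Path x (letters (toFSA i E))
      (readState ([] : GroupWord ι) p) g (readState ([] : GroupWord ι) 1)) hg (.nil _) ?_
    intro p w q g he hq
    have hsub : ∀ f ∈ paddedEdges i (p, w, q), f ∈ (toFSA i E).1 := fun f hf =>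
      List.mem_flatMap.2 ⟨_, he, hf⟩
    have h₁ : (readState ([] : GroupWord ι) p, [(i, true)], readState ((i, false) :: w) q) ∈
        letters (toFSA i E) := mem_letters.2 ⟨_, rfl, hsub _ List.mem_cons_self⟩
    have h₂ := path_readEdges (x := x) (𝒜 := toFSA i E) ((i, false) :: w) _ List.suffix_rfl
      fun f hf => hsub f (List.mem_cons_of_mem _ hf)
    simpa [GroupWord.val_cons, mul_assoc] using Path.cons (x := x) h₁ (h₂.trans hq)

end Subdivision

/-! ### Reachability -/

/-- Every list of transitions describes a path: those that do not start at the state reached so far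
are skipped. -/
theorem foldl_reachable (L : List (ℕ × GroupWord ι × ℕ)) (hL : ∀ e ∈ L, e ∈ E)
    (hg : ∃ g, Path x E p g q) :
    ∃ g, Path x E p g (L.foldl (fun s e => if s = e.1 then e.2.2 else s) q) := by
  induction L generalizing q with
  | nil => simpa using hg
  | cons e L ih =>
    refine ih (fun f hf => hL f (List.mem_cons_of_mem _ hf)) ?_
    obtain ⟨g, hg⟩ := hg
    dsimp only
    split_ifs with h
    · subst h
      exact ⟨_, hg.trans (Path.single (hL _ List.mem_cons_self))⟩
    · exact ⟨g, hg⟩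

theorem exists_foldl_of_path (hg : Path x E p g q) : ∃ L : List (ℕ × GroupWord ι × ℕ),
    (∀ e ∈ L, e ∈ E) ∧ L.foldl (fun s e => if s = e.1 then e.2.2 else s) p = q := by
  induction hg with
  | nil => exact ⟨[], by simp⟩
  | @cons p r q w g he _ ih =>
    obtain ⟨L, hL, h⟩ := ih
    refine ⟨(p, w, r) :: L, ?_, by simpa using h⟩
    simpa using ⟨he, fun a b c => hL (a, b, c)⟩

/-- A finite set of states, as a list, that contains `0` and is closed under transitions. -/
theorem exists_forward_closed (x : ι → G) (E : WordAutomaton ι) : ∃ P : List ℕ, 0 ∈ P ∧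
    (∀ e ∈ E, e.1 ∈ P → e.2.2 ∈ P) ∧ ∀ p ∈ P, ∃ g, Path x E 0 g p := by
  classical
  refine ⟨0 :: (E.map fun e => e.2.2).filter fun p => ∃ g, Path x E 0 g p, by simp, ?_, ?_⟩
  · rintro ⟨p, w, q⟩ he hp
    have hp' : ∃ g, Path x E 0 g p := by
      rcases List.mem_cons.1 hp with rfl | hp
      · exact ⟨1, .nil _⟩
      · simpa using (List.mem_filter.1 hp).2
    obtain ⟨g, hg⟩ := hp'
    refine List.mem_cons_of_mem _ (List.mem_filter.2 ⟨List.mem_map.2 ⟨_, he, rfl⟩, ?_⟩)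
    simpa using ⟨_, hg.trans (.single he)⟩
  · intro p hp
    rcases List.mem_cons.1 hp with rfl | hp
    · exact ⟨1, .nil _⟩
    · simpa using (List.mem_filter.1 hp).2

/-- A finite set of states, as a list, that contains `1` and is closed under transitions in the
backward direction. -/
theorem exists_backward_closed (x : ι → G) (E : WordAutomaton ι) : ∃ P : List ℕ, 1 ∈ P ∧
    (∀ e ∈ E, e.2.2 ∈ P → e.1 ∈ P) ∧ ∀ p ∈ P, ∃ g, Path x E p g 1 := by
  classical
  refine ⟨1 :: (E.map fun e => e.1).filter fun p => ∃ g, Path x E p g 1, by simp, ?_, ?_⟩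
  · rintro ⟨p, w, q⟩ he hq
    have hq' : ∃ g, Path x E q g 1 := by
      rcases List.mem_cons.1 hq with rfl | hq
      · exact ⟨1, .nil _⟩
      · simpa using (List.mem_filter.1 hq).2
    obtain ⟨g, hg⟩ := hq'
    refine List.mem_cons_of_mem _ (List.mem_filter.2 ⟨List.mem_map.2 ⟨_, he, rfl⟩, ?_⟩)
    simpa using ⟨_, Path.cons he hg⟩
  · intro p hp
    rcases List.mem_cons.1 hp with rfl | hp
    · exact ⟨1, .nil _⟩
    · simpa using (List.mem_filter.1 hp).2

theorem Path.mem_of_forward_closed {P : List ℕ} (hP : ∀ e ∈ E, e.1 ∈ P → e.2.2 ∈ P)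
    (hg : Path x E p g q) (hp : p ∈ P) : q ∈ P := by
  induction hg with
  | nil => exact hp
  | cons he _ ih => exact ih (hP _ he hp)

theorem Path.mem_of_backward_closed {P : List ℕ} (hP : ∀ e ∈ E, e.2.2 ∈ P → e.1 ∈ P)
    (hg : Path x E p g q) (hq : q ∈ P) : p ∈ P := by
  induction hg with
  | nil => exact hq
  | cons he _ ih => exact hP _ he (ih hq)

end WordAutomaton

/-! ### The algorithms for rational subsets in terms of word automata -/

namespace WordAutomaton

section Sandwich

variable {ι G : Type*} [Group G]

/-- An automaton for `u * R * h * K * v`, where `R` is the image of `E` and `K` is the submonoid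
generated by the words in the list `k`. The states of `E` are shifted by three; at the state `2`
the generators of `K` are read. -/
def sandwich (u : GroupWord ι) (E : WordAutomaton ι) (h : GroupWord ι) (k : List (GroupWord ι))
    (v : GroupWord ι) : WordAutomaton ι :=
  (0, u, 3) :: (4, h, 2) :: (2, v, 1) ::
    (k.map (fun a => (2, a, 2)) ++ E.map fun e => (e.1 + 3, e.2.1, e.2.2 + 3))

theorem mem_image_sandwich_iff (x : ι → G) (u : GroupWord ι) (E : WordAutomaton ι)
    (h : GroupWord ι) (k : List (GroupWord ι)) (v : GroupWord ι) (g : G) :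
    g ∈ (sandwich u E h k v).image x ↔ ∃ r ∈ E.image x,
      ∃ a ∈ Submonoid.closure {a | ∃ w ∈ k, GroupWord.val x w = a},
        g = u.val x * r * h.val x * a * v.val x := by
  set K := Submonoid.closure {a | ∃ w ∈ k, GroupWord.val x w = a} with hK
  constructor
  · intro hg
    have := Path.invariant (C := fun s g => (s = 1 → g = 1) ∧
      (s = 2 → ∃ a ∈ K, g = a * v.val x) ∧
      (∀ p, s = p + 3 → ∃ r, Path x E p r 1 ∧ ∃ a ∈ K, g = r * h.val x * a * v.val x) ∧
      (s = 0 → ∃ r ∈ E.image x, ∃ a ∈ K, g = u.val x * r * h.val x * a * v.val x)) hg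
      (by simp) ?_
    · exact this.2.2.2 rfl
    · rintro p w q g he ⟨h₁, h₂, h₃, -⟩
      simp only [sandwich, List.mem_cons, List.mem_append, List.mem_map, Prod.mk.injEq] at he
      rcases he with ⟨rfl, rfl, rfl⟩ | ⟨rfl, rfl, rfl⟩ | ⟨rfl, rfl, rfl⟩ |
        ⟨b, hb, rfl, rfl, rfl⟩ | ⟨⟨p, w, q⟩, hE, rfl, rfl, rfl⟩
      · refine ⟨by simp, by simp, by simp, fun _ => ?_⟩
        obtain ⟨r, hr, a, ha, rfl⟩ := h₃ 0 rfl
        exact ⟨r, hr, a, ha, by simp only [mul_assoc]⟩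
      · refine ⟨by simp, by simp, fun p hp => ?_, by simp⟩
        obtain rfl : 1 = p := by omega
        obtain ⟨a, ha, rfl⟩ := h₂ rfl
        exact ⟨1, .nil _, a, ha, by simp only [one_mul, mul_assoc]⟩
      · exact ⟨by simp, fun _ => ⟨1, one_mem _, by simp [h₁ rfl]⟩, by simp, by simp⟩
      · refine ⟨by simp, fun _ => ?_, by simp, by simp⟩
        obtain ⟨a, ha, rfl⟩ := h₂ rfl
        exact ⟨b.val x * a, mul_mem (Submonoid.subset_closure ⟨b, hb, rfl⟩) ha,
          by simp only [mul_assoc]⟩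
      · refine ⟨by simp, by simp, fun p' hp => ?_, by simp⟩
        obtain rfl : p = p' := by simpa using hp
        obtain ⟨r, hr, a, ha, rfl⟩ := h₃ q rfl
        exact ⟨_, .cons hE hr, a, ha, by simp only [mul_assoc]⟩
  · rintro ⟨r, hr, a, ha, rfl⟩
    have h₁ : Path x (sandwich u E h k v) 0 (u.val x) 3 := .single (by simp [sandwich])
    have h₂ : Path x (sandwich u E h k v) 4 (h.val x) 2 := .single (by simp [sandwich])
    have h₃ : Path x (sandwich u E h k v) 2 (v.val x) 1 := .single (by simp [sandwich])
    have h₄ : Path x (sandwich u E h k v) 2 a 2 := by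
      induction ha using Submonoid.closure_induction with
      | mem a ha =>
        obtain ⟨w, hw, rfl⟩ := ha
        exact .single (by simp [sandwich, hw])
      | one => exact .nil _
      | mul a b _ _ ha hb => exact ha.trans hb
    have h₅ : Path x (sandwich u E h k v) 3 r 4 := by
      refine Path.invariant (C := fun p g => Path x (sandwich u E h k v) (p + 3) g 4) hr
        (.nil _) fun p w q g he hq => .cons ?_ hq
      simp only [sandwich, List.mem_cons, List.mem_append, List.mem_map]
      exact .inr (.inr (.inr (.inr ⟨_, he, rfl⟩)))
    exact (((h₁.trans h₅).trans h₂).trans h₄).trans h₃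

theorem computable_sandwich [Primcodable ι] {α : Type*} [Primcodable α] {u h v : α → GroupWord ι}
    {E : α → WordAutomaton ι} {k : α → List (GroupWord ι)} (hu : Computable u) (hE : Computable E)
    (hh : Computable h) (hk : Computable k) (hv : Computable v) :
    Computable fun a => sandwich (u a) (E a) (h a) (k a) (v a) := by
  have add3 : Computable fun p : ℕ => p + 3 :=
    (Primrec.succ.comp (Primrec.succ.comp Primrec.succ)).to_comp
  refine Computable.list_cons.comp
    ((Computable.const 0).pair (hu.pair (Computable.const 3)))
    (Computable.list_cons.comp ((Computable.const 4).pair (hh.pair (Computable.const 2)))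
      (Computable.list_cons.comp ((Computable.const 2).pair (hv.pair (Computable.const 1)))
        (Computable.list_append.comp (Computable.list_map hk ?_) (Computable.list_map hE ?_))))
  · exact (Computable.const 2).pair (Computable.snd.pair (Computable.const 2))
  · exact (add3.comp (Computable.fst.comp Computable.snd)).pair
      ((Computable.fst.comp (Computable.snd.comp Computable.snd)).pair
        (add3.comp (Computable.snd.comp (Computable.snd.comp Computable.snd))))

theorem image_singleton (x : ι → G) (w : GroupWord ι) :
    image x [(0, w, 1)] = {GroupWord.val x w} := by
  ext g
  rw [Set.mem_singleton_iff]
  constructor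
  · intro hg
    have := Path.invariant (C := fun s g => (s = 1 → g = 1) ∧ (s = 0 → g = w.val x)) hg
      (by simp) ?_
    · exact this.2 rfl
    · rintro p v q g he ⟨h₁, -⟩
      simp only [List.mem_singleton, Prod.mk.injEq] at he
      obtain ⟨rfl, rfl, rfl⟩ := he
      simp [h₁ rfl]
  · rintro rfl
    exact Path.single (by simp)

end Sandwich

section Oracles

variable {ι G : Type*} [Primcodable ι] [Group G]

theorem computablePred_foldl_eq_one : ComputablePred fun L : WordAutomaton ι =>
    L.foldl (fun s e => if s = e.1 then e.2.2 else s) 0 = 1 := by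
  refine Computable.computablePred_eq ?_ (Computable.const 1)
  refine Computable.list_foldl (h := fun _ (q : ℕ × ℕ × GroupWord ι × ℕ) =>
    if q.1 = q.2.1 then q.2.2.2 else q.1) Computable.id (Computable.const 0) ?_
  refine Primrec.to_comp (Primrec.ite (Primrec.eq.comp ?_ ?_) ?_ ?_)
  · exact Primrec.fst.comp Primrec.snd
  · exact Primrec.fst.comp (Primrec.snd.comp Primrec.snd)
  · exact Primrec.snd.comp (Primrec.snd.comp (Primrec.snd.comp Primrec.snd))
  · exact Primrec.fst.comp Primrec.snd

theorem computablePred_forward_closed {α : Type*} [Primcodable α] {E : α → WordAutomaton ι}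
    {P : α → List ℕ} (hE : Computable E) (hP : Computable P) :
    ComputablePred fun a => ∀ e ∈ E a, e.1 ∈ P a → e.2.2 ∈ P a :=
  ComputablePred.forall_mem (p := fun a e => e.1 ∈ P a → e.2.2 ∈ P a) hE
    ((Computable.computablePred_mem (Computable.fst.comp Computable.snd)
      (hP.comp Computable.fst)).imp
      (Computable.computablePred_mem (Computable.snd.comp (Computable.snd.comp Computable.snd))
        (hP.comp Computable.fst)))

theorem computablePred_backward_closed {α : Type*} [Primcodable α] {E : α → WordAutomaton ι}
    {P : α → List ℕ} (hE : Computable E) (hP : Computable P) :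
    ComputablePred fun a => ∀ e ∈ E a, e.2.2 ∈ P a → e.1 ∈ P a :=
  ComputablePred.forall_mem (p := fun a e => e.2.2 ∈ P a → e.1 ∈ P a) hE
    ((Computable.computablePred_mem (Computable.snd.comp (Computable.snd.comp Computable.snd))
      (hP.comp Computable.fst)).imp
      (Computable.computablePred_mem (Computable.fst.comp Computable.snd)
        (hP.comp Computable.fst)))

/-- Reachability of the final state is decidable, by a search for a certificate: a path to the
final state, or a set of states without it that contains the initial state and is closed under
transitions. -/
theorem computablePred_exists_path (x : ι → G) :
    ComputablePred fun E : WordAutomaton ι => ∃ g, Path x E 0 g 1 := by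
  have hE : Computable fun q : WordAutomaton ι × (Bool × WordAutomaton ι × List ℕ) => q.1 :=
    Computable.fst
  have hb : ComputablePred fun q : WordAutomaton ι × (Bool × WordAutomaton ι × List ℕ) =>
    q.2.1 = true := (Computable.fst.comp Computable.snd).computablePred_eq_true
  have hL : Computable fun q : WordAutomaton ι × (Bool × WordAutomaton ι × List ℕ) => q.2.2.1 :=
    Computable.fst.comp (Computable.snd.comp Computable.snd)
  have hP : Computable fun q : WordAutomaton ι × (Bool × WordAutomaton ι × List ℕ) => q.2.2.2 :=
    Computable.snd.comp (Computable.snd.comp Computable.snd)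
  have hLE : ComputablePred fun q : WordAutomaton ι × (Bool × WordAutomaton ι × List ℕ) =>
      ∀ e ∈ q.2.2.1, e ∈ q.1 :=
    haveI : DecidableEq ι := Encodable.decidableEqOfEncodable _
    ComputablePred.forall_mem hL
      (Computable.computablePred_mem Computable.snd (hE.comp Computable.fst))
  obtain ⟨c, hc, hcC⟩ := ComputablePred.exists_computable_choice
    (P := fun (E : WordAutomaton ι) (c : Bool × WordAutomaton ι × List ℕ) =>
      (c.1 = true → (∀ e ∈ c.2.1, e ∈ E) ∧
        c.2.1.foldl (fun s e => if s = e.1 then e.2.2 else s) 0 = 1) ∧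
      (¬ c.1 = true → 0 ∈ c.2.2 ∧ ¬ 1 ∈ c.2.2 ∧ ∀ e ∈ E, e.1 ∈ c.2.2 → e.2.2 ∈ c.2.2))
    ((hb.imp (hLE.and (computablePred_foldl_eq_one.comp hL))).and
      (hb.not.imp ((Computable.computablePred_mem (Computable.const 0) hP).and
        ((Computable.computablePred_mem (Computable.const 1) hP).not.and
          (computablePred_forward_closed hE hP)))))
    fun E => by
      by_cases h : ∃ g, Path x E 0 g 1
      · obtain ⟨g, hg⟩ := h
        obtain ⟨L, hL, h1⟩ := exists_foldl_of_path hg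
        exact ⟨(true, L, []), fun _ => ⟨hL, h1⟩, fun h => absurd rfl h⟩
      · obtain ⟨P, h0, hP, hr⟩ := exists_forward_closed x E
        exact ⟨(false, [], P), fun h => by simp at h, fun _ => ⟨h0, fun h1 => h (hr 1 h1), hP⟩⟩
  refine ComputablePred.of_eq (Computable.fst.comp hc).computablePred_eq_true fun E => ?_
  refine ⟨fun h => ?_, fun ⟨g, hg⟩ => ?_⟩
  · obtain ⟨hL, h1⟩ := (hcC E).1 h
    have := foldl_reachable (x := x) (p := 0) _ hL ⟨1, .nil 0⟩
    rwa [h1] at this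
  · by_contra h
    obtain ⟨h0, h1, hP⟩ := (hcC E).2 h
    exact h1 (hg.mem_of_forward_closed hP h0)

/-- Word automata translate computably into automata with letter transitions. If there are
letters, transitions are subdivided; over the empty alphabet the image is `{1}` or empty, and
reachability of the final state decides which. -/
theorem exists_computable_toFSA (x : ι → G) :
    ∃ F : WordAutomaton ι → FSA (ι × Bool), Computable F ∧ ∀ E, (F E).image x = E.image x := by
  rcases isEmpty_or_nonempty ι with hι | ⟨⟨i⟩⟩
  · have hone : ∀ {E : WordAutomaton ι} {p q g}, Path x E p g q → g = 1 := by
      intro E p q g hg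
      induction hg with
      | nil => rfl
      | @cons _ _ _ w _ _ _ ih =>
        cases w with
        | nil => simp [ih]
        | cons l w => exact hι.elim l.1
    obtain ⟨c, hc, hcE⟩ := (computablePred_exists_path x).exists_bool
    refine ⟨fun E => bif c E then ([], [0], [0]) else ([], [], []),
      Computable.cond hc (Computable.const _) (Computable.const _), fun E => ?_⟩
    ext g
    change g ∈ FSA.image x (bif c E then ([], [0], [0]) else ([], [], [])) ↔ _
    cases h : c E with
    | true =>
      obtain ⟨g₀, hg₀⟩ := (hcE E).1 h
      obtain rfl := hone hg₀
      simp only [cond_true, mem_image_FSA_iff, List.mem_singleton, exists_eq_left]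
      exact ⟨fun hg => by rw [hone hg]; exact hg₀, fun hg => by rw [hone hg]; exact .nil _⟩
    | false =>
      simp only [cond_false, mem_image_FSA_iff, List.not_mem_nil, false_and, exists_false,
        false_iff]
      intro hg
      have := (hcE E).2 ⟨g, hg⟩
      simp [h] at this
  · exact ⟨toFSA i, computable_toFSA i, image_toFSA x i⟩

variable {x : ι → G}

theorem computablePred_one_mem_image (hrat : DecidableRationalMembership x) :
    ComputablePred fun E : WordAutomaton ι => (1 : G) ∈ E.image x := by
  obtain ⟨F, hF, hFE⟩ := exists_computable_toFSA x
  refine (ComputablePred.comp hrat (hF.pair (Computable.const []))).of_eq fun E => ?_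
  rw [← hFE E]
  rfl

theorem exists_computable_inter {H : Subgroup G}
    (hH : EffectivelyClosedForRationalIntersections x H) :
    ∃ f : WordAutomaton ι → WordAutomaton ι, Computable f ∧
      ∀ E, (f E).image x = E.image x ∩ (H : Set G) := by
  obtain ⟨F, hF, hFE⟩ := exists_computable_toFSA x
  obtain ⟨-, f, hf, hfH⟩ := hH
  refine ⟨fun E => ofFSA (f (F E)), computable_ofFSA.comp (hf.comp hF), fun E => ?_⟩
  rw [image_ofFSA, hfH, hFE]

theorem computablePred_val_eq (hrat : DecidableRationalMembership x) :
    ComputablePred fun q : GroupWord ι × GroupWord ι => q.1.val x = q.2.val x := by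
  refine ((computablePred_one_mem_image hrat).comp
    (f := fun q : GroupWord ι × GroupWord ι => [(0, GroupWord.inv q.1 ++ q.2, 1)]) ?_).of_eq
    fun q => ?_
  · exact Computable.list_cons.comp ((Computable.const 0).pair
      ((Computable.list_append.comp (GroupWord.computable_inv.comp Computable.fst)
        Computable.snd).pair (Computable.const 1))) (Computable.const [])
  · rw [image_singleton, Set.mem_singleton_iff, GroupWord.val_append, GroupWord.val_inv,
      eq_comm, inv_mul_eq_one]

theorem decidableMembership_of_fg (hrat : DecidableRationalMembership x) (hx : Generates x)
    {H : Subgroup G} (hH : H.FG) : ComputablePred fun w : GroupWord ι => w.val x ∈ H := by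
  obtain ⟨S, hS⟩ := (Subgroup.fg_iff_submonoid_fg H).1 hH
  choose k hk using hx.exists_word
  have hS' : Submonoid.closure {a | ∃ w ∈ S.toList.map k, GroupWord.val x w = a} =
      H.toSubmonoid := by
    rw [← hS]
    congr 1
    ext a
    simp [hk]
  refine ((computablePred_one_mem_image hrat).comp
    (f := fun w : GroupWord ι => sandwich (GroupWord.inv w) [(0, [], 1)] [] (S.toList.map k) [])
    (computable_sandwich GroupWord.computable_inv (Computable.const _) (Computable.const _)
      (Computable.const _) (Computable.const _))).of_eq fun w => ?_
  rw [mem_image_sandwich_iff, image_singleton, hS']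
  simp only [Set.mem_singleton_iff, exists_eq_left, GroupWord.val_nil, GroupWord.val_inv, mul_one]
  constructor
  · rintro ⟨a, ha, h⟩
    rwa [show w.val x = a from (inv_mul_eq_one.1 h.symm)]
  · exact fun h => ⟨_, h, by simp⟩

/-- A homomorphism on a finitely generated subgroup is computable on words: writing an element of
the subgroup in terms of its generators is a matter of search. -/
theorem exists_computable_hom (hrat : DecidableRationalMembership x) (hx : Generates x)
    {H : Subgroup G} (hH : H.FG) (θ : H →* G) :
    ∃ ψ : GroupWord ι → Option (GroupWord ι), Computable ψ ∧
      (∀ w v, v ∈ ψ w → ∃ h : H, (h : G) = w.val x ∧ v.val x = θ h) ∧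
      ∀ w, w.val x ∈ H → (ψ w).isSome = true := by
  obtain ⟨S, hS⟩ := hH
  have hSH : ∀ s ∈ S, s ∈ H := fun s hs => hS ▸ Subgroup.subset_closure hs
  let y : Fin S.card → H := fun j =>
    ⟨(S.equivFin.symm j : G), hSH _ (S.equivFin.symm j).2⟩
  have hy : ∀ h : H, ∃ v : GroupWord (Fin S.card), v.val y = h := by
    intro h
    have hrange : Set.range (fun j => (y j : G)) = S := by
      ext s
      constructor
      · rintro ⟨j, rfl⟩
        exact (S.equivFin.symm j).2
      · exact fun hs => ⟨S.equivFin ⟨s, hs⟩, by simp [y]⟩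
    obtain ⟨v, hv⟩ := (GroupWord.exists_val_eq_iff_mem_closure (fun j => (y j : G)) h).2
      (by rw [hrange, hS]; exact h.2)
    refine ⟨v, Subtype.ext ?_⟩
    rw [← hv]
    exact GroupWord.map_val H.subtype y v
  choose k hk using hx.exists_word
  let a : Fin S.card → GroupWord ι := fun j => k (y j)
  let b : Fin S.card → GroupWord ι := fun j => k (θ (y j))
  have ha : ∀ v, (GroupWord.subst a v).val x = (v.val y : H) := by
    intro v
    rw [GroupWord.val_subst]
    simp only [a, hk]
    exact (GroupWord.map_val H.subtype y v).symm
  have hb : ∀ v, (GroupWord.subst b v).val x = θ (v.val y) := by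
    intro v
    rw [GroupWord.val_subst]
    simp only [b, hk]
    exact (GroupWord.map_val θ y v).symm
  have hsome : Computable (Option.isSome : Option (GroupWord (Fin S.card)) → Bool) :=
    Primrec.option_isSome.to_comp
  obtain ⟨c, hc, hcP⟩ := ComputablePred.exists_computable_choice
    (P := fun (w : GroupWord ι) (o : Option (GroupWord (Fin S.card))) =>
      (w.val x ∈ H → o.isSome = true) ∧
        (o.isSome = true → (GroupWord.subst a (o.getD [])).val x = w.val x))
    (((decidableMembership_of_fg hrat hx ⟨S, hS⟩).comp Computable.fst).imp
      (hsome.comp Computable.snd).computablePred_eq_true |>.and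
      ((hsome.comp Computable.snd).computablePred_eq_true.imp
        ((computablePred_val_eq hrat).comp (((GroupWord.computable_subst a).comp
          (Computable.option_getD Computable.snd (Computable.const []))).pair Computable.fst))))
    (fun w => by
      by_cases hw : w.val x ∈ H
      · obtain ⟨v, hv⟩ := hy ⟨_, hw⟩
        exact ⟨some v, by simp, fun _ => by simp [ha, hv]⟩
      · exact ⟨none, fun h => absurd h hw, by simp⟩)
  refine ⟨fun w => (c w).map (GroupWord.subst b),
    Computable.option_map hc ((GroupWord.computable_subst b).comp Computable.snd), ?_, ?_⟩
  · intro w v hv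
    obtain ⟨u, hu, rfl⟩ := Option.map_eq_some_iff.1 hv
    refine ⟨u.val y, ?_, hb u⟩
    have := (hcP w).2 (by simp [hu])
    rw [← this, hu, Option.getD_some, ha]
  · intro w hw
    simpa using (hcP w).1 hw

end Oracles

end WordAutomaton

/-! ### The homomorphic image of a rational subset of a subgroup -/

namespace WordAutomaton

variable {ι G : Type*} [Group G]

/-- The word assigned to the state `p` by the finite table `U`. -/
def label (U : List (GroupWord ι)) (p : ℕ) : GroupWord ι := U[p]?.getD []

theorem exists_label_eq (u : ℕ → GroupWord ι) (N : ℕ) : ∃ U, ∀ p < N, label U p = u p :=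
  ⟨(List.range N).map u, fun p hp => by simp [label, hp]⟩

theorem computable_label [Primcodable ι] {α : Type*} [Primcodable α] {U : α → List (GroupWord ι)}
    {p : α → ℕ} (hU : Computable U) (hp : Computable p) :
    Computable fun a => label (U a) (p a) :=
  Computable.option_getD (Computable.list_getElem?.comp hU hp) (Computable.const [])

/-- The label of the transition `e`, corrected by the words that the table `U` assigns to its
ends. -/
def corrected (U : List (GroupWord ι)) (e : ℕ × GroupWord ι × ℕ) : GroupWord ι :=
  label U e.1 ++ e.2.1 ++ GroupWord.inv (label U e.2.2)

/-- The transitions of `E` whose corrected label is in the domain of the partial function `ψ`,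
relabelled by its value. -/
def relabel (ψ : GroupWord ι → Option (GroupWord ι)) (E : WordAutomaton ι)
    (U : List (GroupWord ι)) : WordAutomaton ι :=
  E.filterMap fun e => (ψ (corrected U e)).map fun v => (e.1, v, e.2.2)

variable {x : ι → G} {H : Subgroup G} {θ : H →* G} {ψ : GroupWord ι → Option (GroupWord ι)}
  {E : WordAutomaton ι} {U : List (GroupWord ι)} {p q : ℕ} {g : G}

theorem Path.of_relabel (hψ : ∀ w v, v ∈ ψ w → ∃ h : H, (h : G) = w.val x ∧ v.val x = θ h)
    (hg : Path x (relabel ψ E U) p g q) :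
    ∃ h : H, θ h = g ∧
      Path x E p (((label U p).val x)⁻¹ * h * (label U q).val x) q := by
  refine hg.invariant (C := fun p g => ∃ h : H, θ h = g ∧
      Path x E p (((label U p).val x)⁻¹ * h * (label U q).val x) q)
    ⟨1, map_one _, by simpa using Path.nil q⟩ ?_
  rintro p v r _ he ⟨h, rfl, hr⟩
  simp only [relabel, List.mem_filterMap, Option.map_eq_some_iff, Prod.mk.injEq] at he
  obtain ⟨⟨a, w, b⟩, he, v, hv, rfl, rfl, rfl⟩ := he
  obtain ⟨h', hh', hv⟩ := hψ _ _ hv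
  refine ⟨h' * h, by rw [map_mul, hv], ?_⟩
  convert! Path.cons he hr using 1
  rw [Subgroup.coe_mul, hh']
  simp [corrected, mul_assoc]

theorem Path.relabel (hψ : ∀ w v, v ∈ ψ w → ∃ h : H, (h : G) = w.val x ∧ v.val x = θ h)
    {P P' : List ℕ} (hP : ∀ e ∈ E, e.1 ∈ P → e.2.2 ∈ P) (hP' : ∀ e ∈ E, e.2.2 ∈ P' → e.1 ∈ P')
    (hU : ∀ e ∈ E, e.1 ∈ P → e.2.2 ∈ P' → (ψ (corrected U e)).isSome = true)
    (hg : Path x E p g q) (hp : p ∈ P) (hq : q ∈ P') :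
    ∃ h : H, (h : G) = (label U p).val x * g * ((label U q).val x)⁻¹ ∧
      Path x (relabel ψ E U) p (θ h) q := by
  induction hg with
  | nil p => exact ⟨1, by simp, by simpa using Path.nil p⟩
  | @cons p r q w g he hr ih =>
    obtain ⟨h, hh, hr'⟩ := ih (hP _ he hp) hq
    obtain ⟨v, hv⟩ := Option.isSome_iff_exists.1
      (hU _ he hp (hr.mem_of_backward_closed hP' hq))
    obtain ⟨h', hh', hv'⟩ := hψ _ _ hv
    refine ⟨h' * h, ?_, ?_⟩
    · rw [Subgroup.coe_mul, hh, hh']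
      simp [corrected, mul_assoc]
    · rw [map_mul, ← hv']
      refine Path.cons (List.mem_filterMap.2 ⟨_, he, ?_⟩) hr'
      simp [hv]

/-- A certificate `(U, P, P')` for the automaton `E`: the table `U` assigns words to the states,
trivial ones to the initial and to the final state; `P` contains the accessible states and `P'`
the coaccessible ones; and the corrected labels of the transitions from `P` to `P'` are in the
domain of `ψ`. -/
def IsCertificate (ψ : GroupWord ι → Option (GroupWord ι)) (E : WordAutomaton ι)
    (c : List (GroupWord ι) × List ℕ × List ℕ) : Prop :=
  (label c.1 0).length = 0 ∧ (label c.1 1).length = 0 ∧ 0 ∈ c.2.1 ∧ 1 ∈ c.2.2 ∧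
    (∀ e ∈ E, e.1 ∈ c.2.1 → e.2.2 ∈ c.2.1) ∧ (∀ e ∈ E, e.2.2 ∈ c.2.2 → e.1 ∈ c.2.2) ∧
    ∀ e ∈ E, e.1 ∈ c.2.1 → e.2.2 ∈ c.2.2 → (ψ (corrected c.1 e)).isSome = true

theorem IsCertificate.mem_image_relabel_iff
    (hψ : ∀ w v, v ∈ ψ w → ∃ h : H, (h : G) = w.val x ∧ v.val x = θ h)
    {c : List (GroupWord ι) × List ℕ × List ℕ} (hc : IsCertificate ψ E c) :
    g ∈ (WordAutomaton.relabel ψ E c.1).image x ↔ ∃ h : H, (h : G) ∈ E.image x ∧ θ h = g := by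
  obtain ⟨h0, h1, hP0, hP1, hP, hP', hU⟩ := hc
  rw [List.length_eq_zero_iff] at h0 h1
  constructor
  · intro hg
    obtain ⟨h, rfl, hh⟩ := Path.of_relabel hψ hg
    exact ⟨h, by simpa [image, h0, h1] using hh, rfl⟩
  · rintro ⟨h, hh, rfl⟩
    obtain ⟨h', hh', hp⟩ := Path.relabel hψ hP hP' hU hh hP0 hP1
    obtain rfl : h' = h := Subtype.ext (by simpa [h0, h1] using hh')
    exact hp

/-- The word for a state `p` is read along some path from the initial state to `p`. If two states
`p`, `q` are useful and `w` labels a transition from `p` to `q`, then the corrected label is in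
the subgroup because a successful path passes through the transition. -/
theorem exists_isCertificate (hx : Generates x) (hψ : ∀ w, w.val x ∈ H → (ψ w).isSome = true)
    (hE : E.image x ⊆ H) : ∃ c, IsCertificate ψ E c := by
  obtain ⟨P, hP0, hP, hPr⟩ := exists_forward_closed x E
  obtain ⟨P', hP1, hP', hPr'⟩ := exists_backward_closed x E
  have hu : ∀ p, ∃ u : GroupWord ι, (p = 0 ∨ p = 1 → u = []) ∧
      (p ∈ P → ∀ g, Path x E p g 1 → u.val x * g ∈ H) := by
    intro p
    by_cases h0 : p = 0
    · subst h0
      exact ⟨[], by simp, fun _ g hg => by simpa using hE hg⟩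
    by_cases hp : p ∈ P
    · obtain ⟨a, ha⟩ := hPr p hp
      by_cases h1 : p = 1
      · subst h1
        refine ⟨[], by simp, fun _ g hg => ?_⟩
        have := mul_mem (inv_mem (show a ∈ H from hE ha)) (show a * g ∈ H from hE (ha.trans hg))
        simpa using this
      · obtain ⟨u, rfl⟩ := hx.exists_word a
        exact ⟨u, by simp [h0, h1], fun _ g hg => hE (ha.trans hg)⟩
    · exact ⟨[], by simp, fun h => absurd h hp⟩
  choose u hu01 hu using hu
  have hN : ∃ N, 2 ≤ N ∧ ∀ e ∈ E, e.1 < N ∧ e.2.2 < N := by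
    clear hE hP hPr hP' hPr' hu
    induction E with
    | nil => exact ⟨2, le_rfl, by simp⟩
    | cons e E ih =>
      obtain ⟨N, h2, hN⟩ := ih
      refine ⟨N + e.1 + e.2.2 + 1, by omega, fun f hf => ?_⟩
      rcases List.mem_cons.1 hf with rfl | hf
      · omega
      · have := hN f hf
        omega
  obtain ⟨N, h2, hN⟩ := hN
  obtain ⟨U, hU⟩ := exists_label_eq u N
  refine ⟨(U, P, P'), ?_, ?_, hP0, hP1, hP, hP', ?_⟩
  · simp [hU 0 (by omega), hu01 0]
  · simp [hU 1 (by omega), hu01 1]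
  · rintro ⟨p, w, q⟩ he hp hq
    obtain ⟨hpN, hqN⟩ := hN _ he
    obtain ⟨g, hg⟩ := hPr' q hq
    refine hψ _ ?_
    have h₁ := hu p hp _ (.cons he hg)
    have h₂ := hu q (hP _ he hp) _ hg
    have := mul_mem h₁ (inv_mem h₂)
    simpa [corrected, hU _ hpN, hU _ hqN, mul_assoc] using this

theorem computablePred_isCertificate [Primcodable ι] (hψ : Computable ψ)
    {f : WordAutomaton ι → WordAutomaton ι} (hf : Computable f) :
    ComputablePred fun q : WordAutomaton ι × (List (GroupWord ι) × List ℕ × List ℕ) =>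
      IsCertificate ψ (f q.1) q.2 := by
  have hE : Computable fun q : WordAutomaton ι × (List (GroupWord ι) × List ℕ × List ℕ) =>
    f q.1 := hf.comp Computable.fst
  have hU : Computable fun q : WordAutomaton ι × (List (GroupWord ι) × List ℕ × List ℕ) =>
    q.2.1 := Computable.fst.comp Computable.snd
  have hP : Computable fun q : WordAutomaton ι × (List (GroupWord ι) × List ℕ × List ℕ) =>
    q.2.2.1 := Computable.fst.comp (Computable.snd.comp Computable.snd)
  have hP' : Computable fun q : WordAutomaton ι × (List (GroupWord ι) × List ℕ × List ℕ) =>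
    q.2.2.2 := Computable.snd.comp (Computable.snd.comp Computable.snd)
  refine .and ?_ (.and ?_ (.and ?_ (.and ?_ (.and ?_ (.and ?_ ?_)))))
  · exact Computable.computablePred_eq
      (Computable.list_length.comp (computable_label hU (Computable.const 0))) (Computable.const 0)
  · exact Computable.computablePred_eq
      (Computable.list_length.comp (computable_label hU (Computable.const 1))) (Computable.const 0)
  · exact Computable.computablePred_mem (Computable.const 0) hP
  · exact Computable.computablePred_mem (Computable.const 1) hP'
  · exact computablePred_forward_closed hE hP
  · exact computablePred_backward_closed hE hP'
  · refine ComputablePred.forall_mem (p := fun q e => e.1 ∈ q.2.2.1 → e.2.2 ∈ q.2.2.2 →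
      (ψ (corrected q.2.1 e)).isSome = true) hE (.imp ?_ (.imp ?_ ?_))
    · exact Computable.computablePred_mem (Computable.fst.comp Computable.snd)
        (hP.comp Computable.fst)
    · exact Computable.computablePred_mem
        (Computable.snd.comp (Computable.snd.comp Computable.snd)) (hP'.comp Computable.fst)
    · refine (Primrec.option_isSome.to_comp.comp (hψ.comp ?_)).computablePred_eq_true
      exact Computable.list_append.comp (Computable.list_append.comp
        (computable_label (hU.comp Computable.fst) (Computable.fst.comp Computable.snd))
        (Computable.fst.comp (Computable.snd.comp Computable.snd)))
        (GroupWord.computable_inv.comp (computable_label (hU.comp Computable.fst)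
          (Computable.snd.comp (Computable.snd.comp Computable.snd))))

theorem computable_relabel [Primcodable ι] (hψ : Computable ψ) :
    Computable₂ (WordAutomaton.relabel ψ) := by
  refine Computable.list_filterMap Computable.fst (Computable.option_map (hψ.comp ?_) ?_)
  · exact Computable.list_append.comp (Computable.list_append.comp
      (computable_label (Computable.snd.comp Computable.fst) (Computable.fst.comp Computable.snd))
      (Computable.fst.comp (Computable.snd.comp Computable.snd)))
      (GroupWord.computable_inv.comp (computable_label (Computable.snd.comp Computable.fst)
        (Computable.snd.comp (Computable.snd.comp Computable.snd))))
  · exact (Computable.fst.comp (Computable.snd.comp Computable.fst)).pair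
      (Computable.snd.pair (Computable.snd.comp (Computable.snd.comp
        (Computable.snd.comp Computable.fst))))

/-- A homomorphism on a finitely generated subgroup `H` that is effectively closed for rational
intersections maps `R ∩ H`, for `R` rational, to a rational subset, effectively. -/
theorem exists_computable_map_inter [Primcodable ι] (hrat : DecidableRationalMembership x)
    (hx : Generates x) (hH : H.FG) (hclosed : EffectivelyClosedForRationalIntersections x H)
    (θ : H →* G) :
    ∃ Φ : WordAutomaton ι → WordAutomaton ι, Computable Φ ∧
      ∀ E g, g ∈ (Φ E).image x ↔ ∃ h : H, (h : G) ∈ E.image x ∧ θ h = g := by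
  obtain ⟨ψ, hψ, hψ₁, hψ₂⟩ := exists_computable_hom hrat hx hH θ
  obtain ⟨f, hf, hfH⟩ := exists_computable_inter hclosed
  obtain ⟨c, hc, hcE⟩ := (computablePred_isCertificate hψ hf).exists_computable_choice fun E =>
    exists_isCertificate hx hψ₂ (by rw [hfH]; exact Set.inter_subset_right)
  refine ⟨fun E => WordAutomaton.relabel ψ (f E) (c E).1,
    (computable_relabel hψ).comp hf (Computable.fst.comp hc), fun E g => ?_⟩
  rw [(hcE E).mem_image_relabel_iff hψ₁, hfH]
  simp

end WordAutomaton

/-! ### Reduced words in the HNN extension -/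

section Reduced

open HNNExtension HNNExtension.NormalWord

variable {G : Type*} [Group G] {A B : Subgroup G}

/-- The value of a list of syllables `t ^ u * g`. -/
def syllableProd (φ : A ≃* B) (l : List (ℤˣ × G)) : HNNExtension G A B φ :=
  (l.map fun a => t ^ (a.1 : ℤ) * of a.2).prod

/-- A list of syllables without pinches `t ^ u * g * t ^ (-u)`, where `g` is in the subgroup that
`t ^ u` conjugates into `G`. -/
def IsReducedList (A B : Subgroup G) (l : List (ℤˣ × G)) : Prop :=
  l.IsChain fun a b => a.2 ∈ toSubgroup A B a.1 → a.1 = b.1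

/-- The submonoid generated by `G` and the stable letter. -/
def positiveSubmonoid (φ : A ≃* B) : Submonoid (HNNExtension G A B φ) :=
  Submonoid.closure (Set.range of ∪ {stableLetter})

variable {φ : A ≃* B} {l m : List (ℤˣ × G)} {g h : G} {u : ℤˣ}

@[simp]
theorem syllableProd_nil : syllableProd φ [] = 1 := rfl

@[simp]
theorem syllableProd_cons : syllableProd φ ((u, g) :: l) = t ^ (u : ℤ) * of g * syllableProd φ l :=
  rfl

theorem of_mem_positiveSubmonoid (g : G) : of g ∈ positiveSubmonoid φ :=
  Submonoid.subset_closure (.inl ⟨g, rfl⟩)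

theorem stableLetter_mem_positiveSubmonoid : stableLetter ∈ positiveSubmonoid φ :=
  Submonoid.subset_closure (.inr rfl)

/-- Britton's lemma for the equality of two reduced words. -/
theorem IsReducedList.eq_of_prod_eq (hl : IsReducedList A B l) (hm : IsReducedList A B m)
    (heq : of g * syllableProd φ l = of h * syllableProd φ m) :
    l.map Prod.fst = m.map Prod.fst ∧
      ∀ u ∈ l.head?.map Prod.fst, g⁻¹ * h ∈ toSubgroup A B (-u) :=
  ReducedWord.map_fst_eq_and_of_prod_eq φ (w₁ := ⟨g, l, hl⟩) (w₂ := ⟨h, m, hm⟩) heq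

theorem isReducedList_of_forall_eq (hl : ∀ a ∈ l, a.1 = u) : IsReducedList A B l := by
  induction l with
  | nil => exact List.isChain_nil
  | cons a l ih =>
    refine List.isChain_cons.2 ⟨fun b hb _ => ?_, ih fun b hb => hl b (List.mem_cons_of_mem _ hb)⟩
    rw [hl a List.mem_cons_self, hl b (List.mem_cons_of_mem _ (List.mem_of_mem_head? hb))]

/-- Elements of the positive submonoid are the values of words in which only positive powers of
the stable letter `t⁻¹` occur; such words have no pinches. -/
theorem exists_of_mem_positiveSubmonoid {z : HNNExtension G A B φ} (hz : z ∈ positiveSubmonoid φ) :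
    ∃ g l, (∀ a ∈ l, a.1 = (-1 : ℤˣ)) ∧ z = of g * syllableProd φ l := by
  induction hz using Submonoid.closure_induction_left with
  | one => exact ⟨1, [], by simp, by simp⟩
  | mul_left y hy z hz ih =>
    obtain ⟨g, l, hl, rfl⟩ := ih
    rcases hy with ⟨h, rfl⟩ | rfl
    · exact ⟨h * g, l, hl, by simp [mul_assoc]⟩
    · refine ⟨1, (-1, g) :: l, by simpa using hl, by simp [stableLetter, mul_assoc]⟩

theorem IsReducedList.forall_eq_of_mem_positiveSubmonoid (hl : IsReducedList A B l)
    (h : of g * syllableProd φ l ∈ positiveSubmonoid φ) : ∀ a ∈ l, a.1 = (-1 : ℤˣ) := by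
  obtain ⟨h', m, hm, h⟩ := exists_of_mem_positiveSubmonoid h
  have := (hl.eq_of_prod_eq (isReducedList_of_forall_eq hm) h).1
  intro a ha
  have ha' : a.1 ∈ m.map Prod.fst := this ▸ List.mem_map_of_mem ha
  obtain ⟨b, hb, hab⟩ := List.mem_map.1 ha'
  rw [← hab, hm b hb]

theorem IsReducedList.eq_nil_of_prod_eq_of (hl : IsReducedList A B l)
    (heq : of g * syllableProd φ l = of h) : l = [] := by
  have := (hl.eq_of_prod_eq (m := []) (h := h) List.isChain_nil (by simpa using heq)).1
  simpa using this

theorem of_ne_of_mul_stableLetter_mul {z : HNNExtension G A B φ} (hz : z ∈ positiveSubmonoid φ) :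
    of g ≠ of h * stableLetter * z := by
  obtain ⟨k, l, hl, rfl⟩ := exists_of_mem_positiveSubmonoid hz
  intro heq
  have hr : IsReducedList A B ((-1, k) :: l) :=
    isReducedList_of_forall_eq (u := -1) (by simpa using hl)
  have := hr.eq_nil_of_prod_eq_of (φ := φ) (g := h) (h := g)
    (by rw [heq]; simp [stableLetter, mul_assoc])
  simp at this

theorem stableLetter_mul_of (a : A) :
    (stableLetter : HNNExtension G A B φ) * of (φ a : G) = of (a : G) * stableLetter := by
  rw [stableLetter, of_mul_inv_t]

/-- Cancellation of a leading positive syllable: if a reduced word beginning with `g s` equals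
`h s z` for the stable letter `s` and a positive element `z`, then `g` and `h` lie in the same left
coset of `A`, and the difference passes to the other side of `s` by means of `φ`. -/
theorem IsReducedList.exists_of_prod_eq (hl : IsReducedList A B ((-1, g) :: l)) {k : G}
    {z : HNNExtension G A B φ} (hz : z ∈ positiveSubmonoid φ)
    (heq : of k * stableLetter * (of g * syllableProd φ l) = of h * stableLetter * z) :
    ∃ a : A, (a : G) = k⁻¹ * h ∧ of g * syllableProd φ l = of (φ a : G) * z := by
  obtain ⟨k', m, hm, rfl⟩ := exists_of_mem_positiveSubmonoid hz
  have hr : IsReducedList A B ((-1, k') :: m) :=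
    isReducedList_of_forall_eq (u := -1) (by simpa using hm)
  have hmem := (hl.eq_of_prod_eq (φ := φ) (g := k) (h := h) hr
    (by simpa [stableLetter, mul_assoc] using heq)).2 (-1) (by simp)
  rw [neg_neg, toSubgroup_one] at hmem
  refine ⟨⟨k⁻¹ * h, hmem⟩, rfl, ?_⟩
  refine mul_left_cancel (a := of k * stableLetter) ?_
  rw [heq, ← mul_assoc (of k * stableLetter), mul_assoc (of k), stableLetter_mul_of]
  simp [mul_assoc]

end Reduced

/-! ### Computing reduced words -/

namespace GroupWord

open HNNExtension HNNExtension.NormalWord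

section

variable {ι : Type*}

/-- Multiplication on the left by the stable letter (`b = true`) or by its inverse
(`b = false`), with the pinch removed if there is one; `ψ b` is a partial function on words that
computes conjugation by that letter. A list entry `(b, w)` stands for the stable letter or its
inverse, according to `b`, followed by `w`. -/
def pushStable (ψ : Bool → GroupWord ι → Option (GroupWord ι)) (b : Bool)
    (r : GroupWord ι × List (Bool × GroupWord ι)) : GroupWord ι × List (Bool × GroupWord ι) :=
  (r.2.head?.bind fun c => bif c.1 == b then none else
    (ψ b r.1).map fun v => (v ++ c.2, r.2.tail)).getD ([], (b, r.1) :: r.2)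

/-- Multiplication on the left by a letter. -/
def pushLetter (ψ : Bool → GroupWord ι → Option (GroupWord ι)) (l : Option ι × Bool)
    (r : GroupWord ι × List (Bool × GroupWord ι)) : GroupWord ι × List (Bool × GroupWord ι) :=
  l.1.casesOn (pushStable ψ l.2 r) fun i => ((i, l.2) :: r.1, r.2)

/-- A reduced word for the value of `w`: a word over the generators of the base group, followed by
a list of powers of the stable letter with words. -/
def reduce (ψ : Bool → GroupWord ι → Option (GroupWord ι)) (w : GroupWord (Option ι)) :
    GroupWord ι × List (Bool × GroupWord ι) :=
  w.foldr (pushLetter ψ) ([], [])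

variable [Primcodable ι] {ψ : Bool → GroupWord ι → Option (GroupWord ι)}

theorem computable_pushStable (hψ : Computable₂ ψ) : Computable₂ (pushStable ψ) := by
  have h₁ : Computable fun q : Bool × GroupWord ι × List (Bool × GroupWord ι) => q.2.1 :=
    Computable.fst.comp Computable.snd
  have h₂ : Computable fun q : Bool × GroupWord ι × List (Bool × GroupWord ι) => q.2.2 :=
    Computable.snd.comp Computable.snd
  refine Computable.option_getD (Computable.option_bind
    (Primrec.list_head?.to_comp.comp h₂) ?_)
    ((Computable.const []).pair (Computable.list_cons.comp (Computable.fst.pair h₁) h₂))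
  refine Computable.cond ?_ (Computable.const none) (Computable.option_map ?_ ?_)
  · exact Primrec.beq.to_comp.comp (Computable.fst.comp Computable.snd)
      (Computable.fst.comp Computable.fst)
  · exact hψ.comp (Computable.fst.comp Computable.fst) (h₁.comp Computable.fst)
  · exact (Computable.list_append.comp Computable.snd
      (Computable.snd.comp (Computable.snd.comp Computable.fst))).pair
      (Primrec.list_tail.to_comp.comp (h₂.comp (Computable.fst.comp Computable.fst)))

theorem computable_reduce (hψ : Computable₂ ψ) : Computable (reduce ψ) := by
  refine Computable.list_foldr (h := fun _ p => pushLetter ψ p.1 p.2) Computable.id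
    (Computable.const _) ?_
  refine Computable.option_casesOn (Computable.fst.comp (Computable.fst.comp Computable.snd))
    ((computable_pushStable hψ).comp (Computable.snd.comp (Computable.fst.comp Computable.snd))
      (Computable.snd.comp Computable.snd)) ?_
  refine Computable.pair (Computable.list_cons.comp (Computable.snd.pair ?_) ?_) ?_
  · exact Computable.snd.comp (Computable.fst.comp (Computable.snd.comp Computable.fst))
  · exact Computable.fst.comp (Computable.snd.comp (Computable.snd.comp Computable.fst))
  · exact Computable.snd.comp (Computable.snd.comp (Computable.snd.comp Computable.fst))

end

variable {ι G : Type*} [Group G] {A B : Subgroup G} {φ : A ≃* B} {x : ι → G}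
  {ψ : Bool → GroupWord ι → Option (GroupWord ι)}

/-- The exponent of `HNNExtension.t` that corresponds to the stable letter (`true`) or to its
inverse (`false`). -/
def exponent (b : Bool) : ℤˣ := bif b then -1 else 1

/-- The syllables that a list of signs and words stands for. -/
def syllables (x : ι → G) (l : List (Bool × GroupWord ι)) : List (ℤˣ × G) :=
  l.map fun a => (exponent a.1, a.2.val x)

@[simp]
theorem syllables_cons (b : Bool) (w : GroupWord ι) (l : List (Bool × GroupWord ι)) :
    syllables x ((b, w) :: l) = (exponent b, w.val x) :: syllables x l := rfl

theorem pushStable_spec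
    (hψ₁ : ∀ b w v, v ∈ ψ b w → (t : HNNExtension G A B φ) ^ (exponent b : ℤ) * of (w.val x) =
      of (v.val x) * t ^ (exponent b : ℤ))
    (hψ₂ : ∀ b w, w.val x ∈ toSubgroup A B (exponent b) → (ψ b w).isSome = true)
    (b : Bool) (w : GroupWord ι) (l : List (Bool × GroupWord ι))
    (hl : IsReducedList A B (syllables x l)) :
    IsReducedList A B (syllables x (pushStable ψ b (w, l)).2) ∧
      of ((pushStable ψ b (w, l)).1.val x) *
          syllableProd φ (syllables x (pushStable ψ b (w, l)).2) =
        t ^ (exponent b : ℤ) * (of (w.val x) * syllableProd φ (syllables x l)) := by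
  have hpush : (∀ c ∈ l.head?, w.val x ∈ toSubgroup A B (exponent b) → c.1 = b) →
      IsReducedList A B (syllables x ((b, w) :: l)) ∧
      of (GroupWord.val x []) * syllableProd φ (syllables x ((b, w) :: l)) =
        t ^ (exponent b : ℤ) * (of (w.val x) * syllableProd φ (syllables x l)) := by
    intro h
    refine ⟨List.isChain_cons.2 ⟨fun c hc hw => ?_, hl⟩, by simp [mul_assoc]⟩
    simp only [List.head?_map, Option.mem_def, Option.map_eq_some_iff] at hc
    obtain ⟨c, hc, rfl⟩ := hc
    rw [h c hc hw]
  rcases l with _ | ⟨⟨c, w'⟩, l⟩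
  · simpa [pushStable] using hpush (by simp)
  · by_cases hcb : c = b
    · simpa [pushStable, hcb] using hpush (by simp [hcb])
    · obtain rfl : c = !b := Bool.eq_not.2 hcb
      cases hv : ψ b w with
      | none =>
        have hw : w.val x ∉ toSubgroup A B (exponent b) := fun h => by
          simpa [hv] using hψ₂ b w h
        simpa [pushStable, hv] using hpush (fun _ _ h => absurd h hw)
      | some v =>
        have h0 : (t : HNNExtension G A B φ) ^ (exponent b : ℤ) * t ^ (exponent (!b) : ℤ) = 1 := by
          cases b <;> simp [exponent]
        have : pushStable ψ b (w, (!b, w') :: l) = (v ++ w', l) := by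
          simp [pushStable, hv]
        rw [this]
        refine ⟨(List.isChain_cons.1 hl).2, ?_⟩
        calc of ((v ++ w').val x) * syllableProd φ (syllables x l)
            = of (v.val x) * (t ^ (exponent b : ℤ) * t ^ (exponent (!b) : ℤ)) * of (w'.val x) *
                syllableProd φ (syllables x l) := by rw [h0]; simp
          _ = (of (v.val x) * t ^ (exponent b : ℤ)) * (t ^ (exponent (!b) : ℤ) * of (w'.val x) *
                syllableProd φ (syllables x l)) := by simp only [mul_assoc]
          _ = _ := by rw [← hψ₁ b w v hv, mul_assoc]; rfl

theorem reduce_spec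
    (hψ₁ : ∀ b w v, v ∈ ψ b w → (t : HNNExtension G A B φ) ^ (exponent b : ℤ) * of (w.val x) =
      of (v.val x) * t ^ (exponent b : ℤ))
    (hψ₂ : ∀ b w, w.val x ∈ toSubgroup A B (exponent b) → (ψ b w).isSome = true)
    (w : GroupWord (Option ι)) :
    IsReducedList A B (syllables x (reduce ψ w).2) ∧
      of ((reduce ψ w).1.val x) * syllableProd φ (syllables x (reduce ψ w).2) =
        w.val (hnnGenerators φ x) := by
  induction w with
  | nil => exact ⟨List.isChain_nil, by simp [reduce, syllables]⟩
  | cons l w ih =>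
    obtain ⟨h₁, h₂⟩ := ih
    have hr : reduce ψ (l :: w) = pushLetter ψ l (reduce ψ w) := rfl
    rw [hr, val_cons, ← h₂]
    obtain ⟨o, b⟩ := l
    cases o with
    | none =>
      obtain ⟨h₃, h₄⟩ := pushStable_spec hψ₁ hψ₂ b (reduce ψ w).1 _ h₁
      refine ⟨h₃, h₄.trans ?_⟩
      cases b <;> simp [exponent, hnnGenerators, stableLetter]
    | some i =>
      refine ⟨h₁, ?_⟩
      change of (GroupWord.val x ((i, b) :: (reduce ψ w).1)) *
        syllableProd φ (syllables x (reduce ψ w).2) = _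
      cases b <;> simp [val_cons, hnnGenerators, mul_assoc]

/-- In an HNN extension with finitely generated associated subgroups, over a base group with
decidable rational subset membership problem, reduced words are computable. -/
theorem exists_computable_reduce [Primcodable ι] (φ : A ≃* B)
    (hrat : DecidableRationalMembership x) (hx : Generates x) (hA : A.FG) (hB : B.FG) :
    ∃ ρ : GroupWord (Option ι) → GroupWord ι × List (Bool × GroupWord ι), Computable ρ ∧
      ∀ w, IsReducedList A B (syllables x (ρ w).2) ∧
        of ((ρ w).1.val x) * syllableProd φ (syllables x (ρ w).2) =
          w.val (hnnGenerators φ x) := by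
  obtain ⟨ψ, hψ, hψ₁, hψ₂⟩ :=
    WordAutomaton.exists_computable_hom hrat hx hA (B.subtype.comp φ.toMonoidHom)
  obtain ⟨χ, hχ, hχ₁, hχ₂⟩ :=
    WordAutomaton.exists_computable_hom hrat hx hB (A.subtype.comp φ.symm.toMonoidHom)
  refine ⟨reduce fun b w => bif b then χ w else ψ w, computable_reduce
    (Computable.cond Computable.fst (hχ.comp Computable.snd) (hψ.comp Computable.snd)),
    fun w => reduce_spec ?_ ?_ w⟩
  · rintro (_ | _) w v hv
    · obtain ⟨a, ha, hv⟩ := hψ₁ w v hv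
      rw [← ha, hv]
      simpa [exponent] using t_mul_of (φ := φ) a
    · obtain ⟨b, hb, hv⟩ := hχ₁ w v hv
      rw [← hb, hv]
      simpa [exponent] using inv_t_mul_of (φ := φ) b
  · rintro (_ | _) w hw
    · exact hψ₂ w (by simpa [exponent] using hw)
    · exact hχ₂ w (by simpa [exponent] using hw)

end GroupWord

/-! ### The decision procedure -/

section Decision

open HNNExtension WordAutomaton

variable {ι G : Type*} [Group G] {A B : Subgroup G} {φ : A ≃* B}

/-- The submonoid generated by the elements `g * s ^ i * h`, for the triples `(g, i, h)` in the
list `L`, where `g` and `h` are given by words. -/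
def listSubmonoid (s : HNNExtension G A B φ) (x : ι → G)
    (L : List (GroupWord ι × ℕ × GroupWord ι)) : Submonoid (HNNExtension G A B φ) :=
  Submonoid.closure {u | ∃ e ∈ L, u = of (e.1.val x) * s ^ e.2.1 * of (e.2.2.val x)}

/-- Words for those generators of `listSubmonoid s x L` that lie in the base group because `s`
does not occur. -/
def baseWords (L : List (GroupWord ι × ℕ × GroupWord ι)) : List (GroupWord ι) :=
  L.filterMap fun e => if e.2.1 = 0 then some (e.1 ++ e.2.2) else none

/-- The submonoid of the base group generated by `baseWords L`. -/
def baseSubmonoid (x : ι → G) (L : List (GroupWord ι × ℕ × GroupWord ι)) : Submonoid G :=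
  Submonoid.closure {a | ∃ w ∈ baseWords L, w.val x = a}

variable {x : ι → G} {L : List (GroupWord ι × ℕ × GroupWord ι)} {s : HNNExtension G A B φ}

theorem of_mem_listSubmonoid {k : G} (hk : k ∈ baseSubmonoid x L) : of k ∈ listSubmonoid s x L := by
  suffices h : baseSubmonoid x L ≤ (listSubmonoid s x L).comap of from h hk
  refine Submonoid.closure_le.2 ?_
  rintro _ ⟨w, hw, rfl⟩
  simp only [baseWords, List.mem_filterMap, Option.ite_none_right_eq_some, Option.some.injEq] at hw
  obtain ⟨e, he, h0, rfl⟩ := hw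
  exact Submonoid.subset_closure ⟨e, he, by simp [h0]⟩

theorem generator_mem_listSubmonoid {e : GroupWord ι × ℕ × GroupWord ι} (he : e ∈ L) :
    of (e.1.val x) * s ^ e.2.1 * of (e.2.2.val x) ∈ listSubmonoid s x L :=
  Submonoid.subset_closure ⟨e, he, rfl⟩

/-- An element of the submonoid lies in the base group, or its factorization into generators has
a first generator in which `s` occurs. -/
theorem eq_or_eq_of_mem_listSubmonoid {m : HNNExtension G A B φ} (hm : m ∈ listSubmonoid s x L) :
    (∃ k ∈ baseSubmonoid x L, m = of k) ∨
      ∃ k ∈ baseSubmonoid x L, ∃ e ∈ L, ∃ j, e.2.1 = j + 1 ∧ ∃ m' ∈ listSubmonoid s x L,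
        m = of k * (of (e.1.val x) * s ^ (j + 1) * of (e.2.2.val x)) * m' := by
  induction hm using Submonoid.closure_induction_left with
  | one => exact .inl ⟨1, one_mem _, by simp⟩
  | mul_left y hy m hm ih =>
    obtain ⟨e, he, rfl⟩ := hy
    rcases hj : e.2.1 with _ | j
    · have hK : e.1.val x * e.2.2.val x ∈ baseSubmonoid x L := by
        refine Submonoid.subset_closure ⟨e.1 ++ e.2.2, ?_, by simp⟩
        simp only [baseWords, List.mem_filterMap, Option.ite_none_right_eq_some,
          Option.some.injEq]
        exact ⟨e, he, hj, rfl⟩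
      rcases ih with ⟨k, hk, rfl⟩ | ⟨k, hk, e', he', j, hj, m', hm', rfl⟩
      · exact .inl ⟨_, mul_mem hK hk, by simp [mul_assoc]⟩
      · exact .inr ⟨_, mul_mem hK hk, e', he', j, hj, m', hm', by simp [mul_assoc]⟩
    · exact .inr ⟨1, one_mem _, e, he, j, hj, m, hm, by simp⟩

theorem listSubmonoid_le_positiveSubmonoid :
    listSubmonoid (stableLetter : HNNExtension G A B φ) x L ≤ positiveSubmonoid φ := by
  refine Submonoid.closure_le.2 ?_
  rintro _ ⟨e, -, rfl⟩
  exact mul_mem (mul_mem (of_mem_positiveSubmonoid _)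
    (pow_mem stableLetter_mem_positiveSubmonoid _)) (of_mem_positiveSubmonoid _)

/-- The subset `R * s ^ i * h * M`, where `s` is the stable letter, `M` is the submonoid described
by `L`, and the triple `σ` consists of an automaton for the rational subset `R` of the base group,
the exponent `i` and a word for `h`. -/
def stateSet (φ : A ≃* B) (x : ι → G) (L : List (GroupWord ι × ℕ × GroupWord ι))
    (σ : WordAutomaton ι × ℕ × GroupWord ι) : Set (HNNExtension G A B φ) :=
  {y | ∃ r ∈ σ.1.image x, ∃ m ∈ listSubmonoid stableLetter x L,
    y = of r * stableLetter ^ σ.2.1 * of (σ.2.2.val x) * m}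

/-- Quotients of `stateSet φ x L σ` by `w s`, where `s` is the stable letter: for `y` such that
`w s y` has no pinch at the `s`, this product lies in that set if and only if `y` lies in the set of
one of the states in the list. The function `Φ` computes the image of `R ∩ A` under `φ`. -/
def crossings (Φ : WordAutomaton ι → WordAutomaton ι) (L : List (GroupWord ι × ℕ × GroupWord ι))
    (w : GroupWord ι) (σ : WordAutomaton ι × ℕ × GroupWord ι) :
    List (WordAutomaton ι × ℕ × GroupWord ι) :=
  σ.2.1.casesOn
    (L.filterMap fun e => e.2.1.casesOn none fun j =>
      some (Φ (sandwich (GroupWord.inv w) σ.1 σ.2.2 (baseWords L) e.1), j, e.2.2))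
    fun i => [(Φ (sandwich (GroupWord.inv w) σ.1 [] [] []), i, σ.2.2)]

theorem of_mem_stateSet_iff (w : GroupWord ι) (σ : WordAutomaton ι × ℕ × GroupWord ι) :
    of (w.val x) ∈ stateSet φ x L σ ↔ σ.2.1 = 0 ∧
      (1 : G) ∈ (sandwich (GroupWord.inv w) σ.1 σ.2.2 (baseWords L) []).image x := by
  obtain ⟨D, i, h⟩ := σ
  rw [mem_image_sandwich_iff]
  change _ ↔ i = 0 ∧ ∃ r ∈ D.image x, ∃ k ∈ baseSubmonoid x L, _
  constructor
  · rintro ⟨r, hr, m, hm, heq⟩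
    rcases i with _ | i
    · refine ⟨rfl, r, hr, ?_⟩
      rcases eq_or_eq_of_mem_listSubmonoid hm with ⟨k, hk, rfl⟩ |
        ⟨k, hk, e, he, j, hj, m', hm', rfl⟩
      · refine ⟨k, hk, ?_⟩
        have : w.val x = r * h.val x * k := of_injective φ (by simpa using heq)
        simp [this, mul_assoc]
      · refine absurd (heq.trans ?_) (of_ne_of_mul_stableLetter_mul
          (h := r * h.val x * k * e.1.val x)
          (z := stableLetter ^ j * of (e.2.2.val x) * m') (mul_mem (mul_mem (pow_mem
            stableLetter_mem_positiveSubmonoid _) (of_mem_positiveSubmonoid _))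
            (listSubmonoid_le_positiveSubmonoid hm')))
        simp [pow_succ', mul_assoc]
    · refine absurd (heq.trans ?_) (of_ne_of_mul_stableLetter_mul
        (h := r) (z := stableLetter ^ i * of (h.val x) * m) (mul_mem (mul_mem (pow_mem
          stableLetter_mem_positiveSubmonoid _) (of_mem_positiveSubmonoid _))
          (listSubmonoid_le_positiveSubmonoid hm)))
      simp [pow_succ', mul_assoc]
  · rintro ⟨rfl, r, hr, k, hk, heq⟩
    refine ⟨r, hr, of k, of_mem_listSubmonoid hk, ?_⟩
    have : w.val x = r * h.val x * k := by
      simpa [mul_assoc, eq_inv_mul_iff_mul_eq] using heq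
    simp [this]

theorem mem_stateSet_iff_exists_crossings {Φ : WordAutomaton ι → WordAutomaton ι}
    (hΦ : ∀ E g, g ∈ (Φ E).image x ↔ ∃ a : A, (a : G) ∈ E.image x ∧ (φ a : G) = g)
    (w : GroupWord ι) {g : G} {l : List (ℤˣ × G)} (hl : IsReducedList A B ((-1, g) :: l))
    (σ : WordAutomaton ι × ℕ × GroupWord ι) :
    of (w.val x) * stableLetter * (of g * syllableProd φ l) ∈ stateSet φ x L σ ↔
      ∃ τ ∈ crossings Φ L w σ, of g * syllableProd φ l ∈ stateSet φ x L τ := by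
  obtain ⟨D, i, h⟩ := σ
  have hpos : ∀ (j : ℕ) (v : GroupWord ι) (m : HNNExtension G A B φ),
      m ∈ listSubmonoid stableLetter x L →
      stableLetter ^ j * of (v.val x) * m ∈ positiveSubmonoid φ := fun _ _ _ hm =>
    mul_mem (mul_mem (pow_mem stableLetter_mem_positiveSubmonoid _) (of_mem_positiveSubmonoid _))
      (listSubmonoid_le_positiveSubmonoid hm)
  have hback : ∀ (a : A) (r : G) (z : HNNExtension G A B φ), (a : G) = (w.val x)⁻¹ * r →
      of (w.val x) * stableLetter * (of (φ a : G) * z) = of r * stableLetter * z := by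
    intro a r z ha
    rw [← mul_assoc, mul_assoc (of (w.val x)), stableLetter_mul_of, ha]
    simp [mul_assoc]
  constructor
  · rintro ⟨r, hr, m, hm, heq⟩
    rcases i with _ | i
    · rcases eq_or_eq_of_mem_listSubmonoid hm with ⟨k, hk, rfl⟩ |
        ⟨k, hk, e, he, j, hj, m', hm', rfl⟩
      · have := hl.eq_nil_of_prod_eq_of (φ := φ) (g := w.val x) (h := r * h.val x * k)
          (by simpa [stableLetter, mul_assoc] using heq)
        simp at this
      · obtain ⟨a, ha, hy⟩ := hl.exists_of_prod_eq (h := r * h.val x * k * e.1.val x)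
          (hpos j e.2.2 m' hm')
          (heq.trans (by simp [pow_succ', mul_assoc]))
        refine ⟨(Φ (sandwich (GroupWord.inv w) D h (baseWords L) e.1), j, e.2.2),
          List.mem_filterMap.2 ⟨e, he, by simp [hj]⟩, φ a, (hΦ _ _).2 ⟨a, ?_, rfl⟩, m', hm',
          hy.trans (by simp [mul_assoc])⟩
        exact (mem_image_sandwich_iff ..).2 ⟨r, hr, k, hk, by simp [ha, mul_assoc]⟩
    · obtain ⟨a, ha, hy⟩ := hl.exists_of_prod_eq (h := r) (hpos i h m hm)
        (heq.trans (by simp [pow_succ', mul_assoc]))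
      refine ⟨(Φ (sandwich (GroupWord.inv w) D [] [] []), i, h), List.mem_singleton.2 rfl, φ a,
        (hΦ _ _).2 ⟨a, ?_, rfl⟩, m, hm, hy.trans (by simp [mul_assoc])⟩
      exact (mem_image_sandwich_iff ..).2 ⟨r, hr, 1, one_mem _, by simp [ha]⟩
  · rintro ⟨τ, hτ, b, hb, m, hm, heq⟩
    rcases i with _ | i
    · obtain ⟨e, he, hτ⟩ := List.mem_filterMap.1 hτ
      rcases hj : e.2.1 with _ | j
      · simp [hj] at hτ
      · obtain rfl : (Φ (sandwich (GroupWord.inv w) D h (baseWords L) e.1), j, e.2.2) = τ := by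
          simpa [hj] using hτ
        obtain ⟨a, ha, rfl⟩ := (hΦ _ _).1 hb
        obtain ⟨r, hr, k, hk, ha⟩ := (mem_image_sandwich_iff ..).1 ha
        refine ⟨r, hr, _, mul_mem (mul_mem (of_mem_listSubmonoid hk)
          (generator_mem_listSubmonoid he)) hm, ?_⟩
        have hy : of g * syllableProd φ l =
            of (φ a : G) * (stableLetter ^ j * of (e.2.2.val x) * m) :=
          heq.trans (by simp [mul_assoc])
        rw [hy, hback a (r * h.val x * k * e.1.val x) _ (by simpa [mul_assoc] using ha)]
        simp [hj, pow_succ', mul_assoc]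
    · obtain rfl := List.mem_singleton.1 hτ
      obtain ⟨a, ha, rfl⟩ := (hΦ _ _).1 hb
      obtain ⟨r, hr, k, hk, ha⟩ := (mem_image_sandwich_iff ..).1 ha
      obtain rfl : k = 1 := by simpa using hk
      refine ⟨r, hr, m, hm, ?_⟩
      have hy : of g * syllableProd φ l =
          of (φ a : G) * (stableLetter ^ i * of (h.val x) * m) :=
        heq.trans (by simp [mul_assoc])
      rw [hy, hback a r _ (by simpa using ha)]
      simp [pow_succ', mul_assoc]

/-- One step of the decision procedure: the states are replaced by their quotients by the current
word and the stable letter, and the next word becomes the current one. No element of a state set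
has the inverse of the stable letter in its reduced words, so that no state is left after it. -/
def decisionStep (Φ : WordAutomaton ι → WordAutomaton ι)
    (L : List (GroupWord ι × ℕ × GroupWord ι))
    (q : GroupWord ι × List (WordAutomaton ι × ℕ × GroupWord ι)) (a : Bool × GroupWord ι) :
    GroupWord ι × List (WordAutomaton ι × ℕ × GroupWord ι) :=
  (a.2, bif a.1 then q.2.flatMap (crossings Φ L q.1) else [])

theorem stateSet_subset_positiveSubmonoid (σ : WordAutomaton ι × ℕ × GroupWord ι) :
    stateSet φ x L σ ⊆ positiveSubmonoid φ := by
  rintro _ ⟨r, -, m, hm, rfl⟩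
  exact mul_mem (mul_mem (mul_mem (of_mem_positiveSubmonoid _)
    (pow_mem stableLetter_mem_positiveSubmonoid _)) (of_mem_positiveSubmonoid _))
    (listSubmonoid_le_positiveSubmonoid hm)

theorem exists_mem_stateSet_iff {Φ : WordAutomaton ι → WordAutomaton ι}
    (hΦ : ∀ E g, g ∈ (Φ E).image x ↔ ∃ a : A, (a : G) ∈ E.image x ∧ (φ a : G) = g)
    (l : List (Bool × GroupWord ι)) (hl : IsReducedList A B (GroupWord.syllables x l))
    (q : GroupWord ι × List (WordAutomaton ι × ℕ × GroupWord ι)) :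
    (∃ σ ∈ q.2, of (q.1.val x) * syllableProd φ (GroupWord.syllables x l) ∈ stateSet φ x L σ) ↔
      ∃ σ ∈ (l.foldl (decisionStep Φ L) q).2,
        of ((l.foldl (decisionStep Φ L) q).1.val x) ∈ stateSet φ x L σ := by
  induction l generalizing q with
  | nil => simp [GroupWord.syllables]
  | cons a l ih =>
    obtain ⟨b, v⟩ := a
    obtain ⟨w, S⟩ := q
    rw [List.foldl_cons, ← ih (List.isChain_cons.1 hl).2]
    cases b with
    | false =>
      simp only [decisionStep, cond_false, List.not_mem_nil, false_and, exists_false, iff_false]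
      rintro ⟨σ, -, hσ⟩
      have := hl.forall_eq_of_mem_positiveSubmonoid (stateSet_subset_positiveSubmonoid σ hσ) _
        List.mem_cons_self
      exact absurd this (by simp [GroupWord.exponent])
    | true =>
      have hw : of (w.val x) * syllableProd φ (GroupWord.syllables x ((true, v) :: l)) =
          of (w.val x) * stableLetter *
            (of (v.val x) * syllableProd φ (GroupWord.syllables x l)) := by
        simp [GroupWord.exponent, stableLetter, mul_assoc]
      have hl' : IsReducedList A B ((-1, v.val x) :: GroupWord.syllables x l) := hl
      simp only [hw, mem_stateSet_iff_exists_crossings hΦ w hl', decisionStep, cond_true,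
        List.mem_flatMap]
      constructor
      · rintro ⟨σ, hσ, τ, hτ, h⟩
        exact ⟨τ, ⟨σ, hσ, hτ⟩, h⟩
      · rintro ⟨τ, ⟨σ, hσ, hτ⟩, h⟩
        exact ⟨σ, hσ, τ, hτ, h⟩

variable [Primcodable ι]

theorem computable_crossings {Φ : WordAutomaton ι → WordAutomaton ι} (hΦ : Computable Φ)
    (L : List (GroupWord ι × ℕ × GroupWord ι)) : Computable₂ (crossings Φ L) := by
  have hw : Computable fun q : GroupWord ι × WordAutomaton ι × ℕ × GroupWord ι =>
    GroupWord.inv q.1 := GroupWord.computable_inv.comp Computable.fst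
  have hD : Computable fun q : GroupWord ι × WordAutomaton ι × ℕ × GroupWord ι => q.2.1 :=
    Computable.fst.comp Computable.snd
  have hi : Computable fun q : GroupWord ι × WordAutomaton ι × ℕ × GroupWord ι => q.2.2.1 :=
    Computable.fst.comp (Computable.snd.comp Computable.snd)
  have hh : Computable fun q : GroupWord ι × WordAutomaton ι × ℕ × GroupWord ι => q.2.2.2 :=
    Computable.snd.comp (Computable.snd.comp Computable.snd)
  refine Computable.nat_casesOn hi (Computable.list_filterMap (Computable.const L)
    (Computable.nat_casesOn ?_ (Computable.const none) (Computable.option_some.comp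
      (Computable.pair (hΦ.comp (computable_sandwich ?_ ?_ ?_ (Computable.const _) ?_))
        (Computable.snd.pair ?_)))))
    (Computable.list_cons.comp (Computable.pair (hΦ.comp (computable_sandwich ?_ ?_
      (Computable.const _) (Computable.const _) (Computable.const _)))
      (Computable.snd.pair ?_)) (Computable.const []))
  · exact Computable.fst.comp (Computable.snd.comp Computable.snd)
  · exact hw.comp (Computable.fst.comp Computable.fst)
  · exact hD.comp (Computable.fst.comp Computable.fst)
  · exact hh.comp (Computable.fst.comp Computable.fst)
  · exact Computable.fst.comp (Computable.snd.comp Computable.fst)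
  · exact Computable.snd.comp (Computable.snd.comp (Computable.snd.comp Computable.fst))
  · exact hw.comp Computable.fst
  · exact hD.comp Computable.fst
  · exact hh.comp Computable.fst

theorem computable_decisionStep {Φ : WordAutomaton ι → WordAutomaton ι} (hΦ : Computable Φ)
    (L : List (GroupWord ι × ℕ × GroupWord ι)) : Computable₂ (decisionStep Φ L) := by
  refine Computable.pair (Computable.snd.comp Computable.snd)
    (Computable.cond (Computable.fst.comp Computable.snd)
      (Computable.list_flatMap (Computable.snd.comp Computable.fst) ?_) (Computable.const []))
  exact (computable_crossings hΦ L).comp (Computable.fst.comp (Computable.fst.comp Computable.fst))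
    Computable.snd

/-- Membership in a submonoid generated by finitely many elements `g * s ^ i * h`, where `s` is
the stable letter, is decidable. -/
theorem decidableMembership_listSubmonoid (φ : A ≃* B) (hx : Generates x) (hA : A.FG) (hB : B.FG)
    (hrat : DecidableRationalMembership x)
    (hclosed : EffectivelyClosedForRationalIntersections x A)
    (L : List (GroupWord ι × ℕ × GroupWord ι)) :
    DecidableMembership (hnnGenerators φ x)
      (listSubmonoid (stableLetter : HNNExtension G A B φ) x L : Set (HNNExtension G A B φ)) := by
  obtain ⟨ρ, hρ, hρx⟩ := GroupWord.exists_computable_reduce φ hrat hx hA hB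
  obtain ⟨Φ, hΦ, hΦx⟩ := exists_computable_map_inter hrat hx hA hclosed
    (B.subtype.comp φ.toMonoidHom)
  -- The initial state describes the submonoid itself.
  let σ₀ : WordAutomaton ι × ℕ × GroupWord ι := ([(0, [], 1)], 0, [])
  let run : GroupWord (Option ι) → GroupWord ι × List (WordAutomaton ι × ℕ × GroupWord ι) :=
    fun w => (ρ w).2.foldl (decisionStep Φ L) ((ρ w).1, [σ₀])
  have hrun : Computable run := by
    refine Computable.list_foldl (h := fun _ p => decisionStep Φ L p.1 p.2)
      (Computable.snd.comp hρ) ((Computable.fst.comp hρ).pair (Computable.const _)) ?_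
    exact (computable_decisionStep hΦ L).comp (Computable.fst.comp Computable.snd)
      (Computable.snd.comp Computable.snd)
  have hdec : ComputablePred fun w : GroupWord (Option ι) => ∃ σ ∈ (run w).2, σ.2.1 = 0 ∧
      (1 : G) ∈ (sandwich (GroupWord.inv (run w).1) σ.1 σ.2.2 (baseWords L) []).image x := by
    refine ComputablePred.exists_mem (Computable.snd.comp hrun) (.and ?_ ?_)
    · exact Computable.computablePred_eq
        (Computable.fst.comp (Computable.snd.comp Computable.snd)) (Computable.const 0)
    · refine (computablePred_one_mem_image hrat).comp (computable_sandwich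
        (GroupWord.computable_inv.comp (Computable.fst.comp (hrun.comp Computable.fst)))
        (Computable.fst.comp Computable.snd)
        (Computable.snd.comp (Computable.snd.comp Computable.snd)) (Computable.const _)
        (Computable.const _))
  refine hdec.of_eq fun w => ?_
  simp only [← of_mem_stateSet_iff (φ := φ)]
  rw [← exists_mem_stateSet_iff hΦx _ (hρx w).1, (hρx w).2]
  simp [σ₀, stateSet, image_singleton]

end Decision

/-! ### The submonoids of the theorem -/

section Generators

open HNNExtension

variable {ι G : Type*} [Group G] {A B : Subgroup G} {φ : A ≃* B} {x : ι → G}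

theorem exists_listSubmonoid_eq (hx : Generates x) (d : ℕ) (W W' : ℕ → Finset G) :
    ∃ L : List (GroupWord ι × ℕ × GroupWord ι), ∀ s : HNNExtension G A B φ,
      hnnSubmonoid s d W W' = listSubmonoid s x L := by
  choose k hk using hx.exists_word
  refine ⟨(W 0).toList.map (fun g => (k g, 0, [])) ++
    ((List.range' 1 d).flatMap fun i => (W i).toList.map fun g => (k g, i, [])) ++
    ((List.range' 1 d).flatMap fun i => (W' i).toList.map fun g => ([], i, k g)), fun s => ?_⟩
  have hi : ∀ i, i ∈ List.range' 1 d ↔ 1 ≤ i ∧ i ≤ d := by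
    intro i
    rw [List.mem_range'_1]
    omega
  unfold hnnSubmonoid listSubmonoid
  congr 1
  ext u
  simp only [Set.mem_union, Set.mem_ofPred_eq, List.mem_append, List.mem_map, List.mem_flatMap,
    Finset.mem_toList, hi]
  constructor
  · rintro ((⟨g, hg, rfl⟩ | ⟨i, h1, hd, g, hg, rfl⟩) | ⟨i, h1, hd, g, hg, rfl⟩)
    · exact ⟨(k g, 0, []), .inl (.inl ⟨g, hg, rfl⟩), by simp [hk]⟩
    · exact ⟨(k g, i, []), .inl (.inr ⟨i, ⟨h1, hd⟩, g, hg, rfl⟩), by simp [hk]⟩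
    · exact ⟨([], i, k g), .inr ⟨i, ⟨h1, hd⟩, g, hg, rfl⟩, by simp [hk]⟩
  · rintro ⟨e, (⟨g, hg, rfl⟩ | ⟨i, ⟨h1, hd⟩, g, hg, rfl⟩) | ⟨i, ⟨h1, hd⟩, g, hg, rfl⟩, rfl⟩
    · exact .inl (.inl ⟨g, hg, by simp [hk]⟩)
    · exact .inl (.inr ⟨i, h1, hd, g, hg, by simp [hk]⟩)
    · exact .inr ⟨i, h1, hd, g, hg, by simp [hk]⟩

/-- The inverse of a submonoid of the form `listSubmonoid` with respect to `s⁻¹` is of this form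
with respect to `s`. -/
theorem inv_mem_listSubmonoid_iff (s : HNNExtension G A B φ)
    (L : List (GroupWord ι × ℕ × GroupWord ι)) (y : HNNExtension G A B φ) :
    y⁻¹ ∈ listSubmonoid s x (L.map fun e => (GroupWord.inv e.2.2, e.2.1, GroupWord.inv e.1)) ↔
      y ∈ listSubmonoid s⁻¹ x L := by
  unfold listSubmonoid
  rw [← Submonoid.mem_inv, ← Submonoid.closure_inv]
  congr! 2
  ext u
  simp only [Set.mem_inv, Set.mem_ofPred_eq, List.mem_map]
  constructor
  · rintro ⟨_, ⟨e, he, rfl⟩, hu⟩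
    refine ⟨e, he, ?_⟩
    rw [← inv_inv u, hu]
    simp [mul_assoc]
  · rintro ⟨e, he, rfl⟩
    exact ⟨_, ⟨e, he, rfl⟩, by simp [mul_assoc]⟩

end Generators

theorem theoremD {G : Type*} [Group G] (n : ℕ) (x : Fin n → G) (hx : Generates x)
    (A B : Subgroup G) (φ : A ≃* B) (hA : A.FG) (hB : B.FG)
    (hrat : DecidableRationalMembership x)
    (hclosed : EffectivelyClosedForRationalIntersections x A)
    (d : ℕ) (W W' : ℕ → Finset G) :
    DecidableMembership (hnnGenerators φ x)
        (hnnSubmonoid (stableLetter : HNNExtension G A B φ) d W W' :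
          Set (HNNExtension G A B φ)) ∧
      DecidableMembership (hnnGenerators φ x)
        (hnnSubmonoid (stableLetter : HNNExtension G A B φ)⁻¹ d W W' :
          Set (HNNExtension G A B φ)) := by
  obtain ⟨L, hL⟩ := exists_listSubmonoid_eq (φ := φ) hx d W W'
  rw [hL, hL]
  refine ⟨decidableMembership_listSubmonoid φ hx hA hB hrat hclosed L, ?_⟩
  refine ((decidableMembership_listSubmonoid φ hx hA hB hrat hclosed
    (L.map fun e => (GroupWord.inv e.2.2, e.2.1, GroupWord.inv e.1))).comp
    GroupWord.computable_inv).of_eq fun w => ?_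
  rw [GroupWord.val_inv]
  exact inv_mem_listSubmonoid_iff _ _ _
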